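/- **Definitions.** A *$*$-permutation of length $n$* is an infinite sequence $\sigma=\sigma(1)\sigma(2)\dots$ with terms in $\{1,\dots,n\}\cup\{*\}$ in which each of the concrete symbols $1,\dots,n$ occurs exactly once; $*$ is regarded as larger than every concrete symbol. Its linearized forest $\tau(\sigma)$ is built from infinitely many single leaves $0,1,2,\dots$ by adding, for $j=1,\dots,n$ in this order, a binary caret labelled $j$ that joins the two neighbouring trees containing the leaves $p-1$ and $p$, where $p=\sigma^{-1}(j)$. Write $\rho\sim\sigma$ if $\tau(\rho)$ and $\tau(\sigma)$ coincide after the labels of all carets are deleted. The symmetric group $S_n$ is regarded as a set of $*$-permutations ($\sigma$ followed by stars); its $\sim$-classes are the *Tamari classes* of $S_n$. Fix a set $A$ of $n$ positions and let $S_n'$ be the set of the $n!$ $*$-permutations of length $n$ whose concrete symbols are exactly at the positions in $A$. Deleting the stars identifies $S_n'$ with $S_n$, and through it $S_n'$ carries the (left) weak Bruhat order $\preceq$: the reflexive transitive closure of the relation "$\rho=(i\ i{+}1)\circ\sigma$ and $\rho$ is longer than $\sigma$", length being taken with respect to the standard reflections. A $*$-permutation $\sigma$ is *$132$-avoiding*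 if there are no $a<b<c$ with $\sigma(a)<\sigma(c)<\sigma(b)$, and *$231$-avoiding* if there are no $a<b<c$ with $\sigma(c)<\sigma(a)<\sigma(b)$ (in both cases $\sigma(a),\sigma(c)$ are concrete and $\sigma(b)$ may be $*$). Let $P_2=\mathrm{Mon}\langle x_0,x_1,x_2,\dots\mid x_ix_j=x_{j+1}x_i \text{ for } i<j\rangle$. To a $*$-permutation $\sigma$ of length $n$ associate the word $x(\sigma)=x_{\mathsf{inv}_1(\sigma)}\cdots x_{\mathsf{inv}_n(\sigma)}$, where $\mathsf{inv}_j(\sigma)$ is the number of terms (stars included) larger than $j$ to the left of $j$ in $\sigma$. **Statement.** (1) For every $n\ge 0$ and every set $A$ of $n$ positions, each $\sim$-class $C$ of $S_n'$ is an interval $[\underline\sigma,\overline\sigma]$ in the weak Bruhat order on $S_n'$, whose top $\overline\sigma$ is $132$-avoiding and whose bottom $\underline\sigma$ is $231$-avoiding; and, after the identification of $S_n'$ with $S_n$, $C$ is a union of Tamari classes of $S_n$. (2) For every $g\in P_2$ there are $n$, a set $A$ of $n$ positions, and an interval $[\underline\sigma,\overline\sigma]$ of the corresponding $S_n'$ which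 is a $\sim$-class of $S_n'$, with $\overline\sigma$ $132$-avoiding and $\underline\sigma$ $231$-avoiding, such that the $*$-permutations $\sigma$ (of any length) whose word $x(\sigma)$ represents $g$ are exactly the elements of $[\underline\sigma,\overline\sigma]$, and $\sigma\mapsto x(\sigma)$ maps $[\underline\sigma,\overline\sigma]$ bijectively onto the set of all words representing $g$. -/

import Mathlib

/-! ## The weak Bruhat order on the symmetric group -/

/-- The standard reflections `(i i+1)` of the symmetric group on `Fin n`. -/
def IsStandardReflection {n : ℕ} (s : Equiv.Perm (Fin n)) : Prop :=
  ∃ i j : Fin n, j.val = i.val + 1 ∧ s = Equiv.swap i j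

/-- The length of a permutation: the least number of standard reflections whose product it is. -/
noncomputable def permLength {n : ℕ} (α : Equiv.Perm (Fin n)) : ℕ :=
  sInf {k | ∃ l : List (Equiv.Perm (Fin n)),
    (∀ s ∈ l, IsStandardReflection s) ∧ l.prod = α ∧ l.length = k}

/-- The cover relation of the (left) weak Bruhat order: `β = (i i+1) ∘ α` is longer than `α`. -/
def WeakCover {n : ℕ} (α β : Equiv.Perm (Fin n)) : Prop :=
  ∃ s, IsStandardReflection s ∧ β = s * α ∧ permLength α < permLength β

/-- The (left) weak Bruhat order on the symmetric group. -/
def WeakLE {n : ℕ} : Equiv.Perm (Fin n) → Equiv.Perm (Fin n) → Prop :=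
  Relation.ReflTransGen WeakCover

/-! ## `*`-permutations -/

/-- A `*`-permutation of length `n`: an infinite sequence of symbols (positions are counted from
`0`, the `n` concrete symbols are the elements of `Fin n`), in which every concrete symbol occurs
exactly once, all other terms being `*`.  The symbol `*` is `⊤ : WithTop (Fin n)`, so it is larger
than every concrete symbol. -/
structure StarPerm (n : ℕ) where
  toFun : ℕ → WithTop (Fin n)
  existsUnique_pos : ∀ j : Fin n, ∃! p, toFun p = (j : WithTop (Fin n))

namespace StarPerm

/-- The position of the concrete symbol `j`. -/
noncomputable def pos {n : ℕ} (σ : StarPerm n) (j : Fin n) : ℕ :=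
  (σ.existsUnique_pos j).choose

theorem toFun_pos {n : ℕ} (σ : StarPerm n) (j : Fin n) :
    σ.toFun (σ.pos j) = (j : WithTop (Fin n)) :=
  (σ.existsUnique_pos j).choose_spec.1

/-- An occurrence of `132`: positions `a < b < c` with `σ(a) < σ(c) < σ(b)`, where `σ(b)` may be
`*`.  (The terms `σ(a)`, `σ(c)` are automatically concrete.) -/
def Avoids132 {n : ℕ} (σ : StarPerm n) : Prop :=
  ¬ ∃ a b c : ℕ, a < b ∧ b < c ∧ σ.toFun a < σ.toFun c ∧ σ.toFun c < σ.toFun b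

/-- An occurrence of `231`: positions `a < b < c` with `σ(c) < σ(a) < σ(b)`, where `σ(b)` may be
`*`.  (The terms `σ(a)`, `σ(c)` are automatically concrete.) -/
def Avoids231 {n : ℕ} (σ : StarPerm n) : Prop :=
  ¬ ∃ a b c : ℕ, a < b ∧ b < c ∧ σ.toFun c < σ.toFun a ∧ σ.toFun a < σ.toFun b

/-- The inversion number of the concrete symbol `j`: the number of terms, stars included, that are
larger than `j` and to the left of `j`. -/
noncomputable def inv {n : ℕ} (σ : StarPerm n) (j : Fin n) : ℕ :=
  ((Finset.range (σ.pos j)).filter fun p => (j : WithTop (Fin n)) < σ.toFun p).card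

/-- The inversion sequence of a `*`-permutation, as a word in `x₀, x₁, x₂, …`. -/
noncomputable def word {n : ℕ} (σ : StarPerm n) : FreeMonoid ℕ :=
  FreeMonoid.ofList (List.ofFn fun j : Fin n => σ.inv j)

/-- A permutation of `Fin n`, followed by stars. -/
def ofPerm {n : ℕ} (α : Equiv.Perm (Fin n)) : StarPerm n where
  toFun p := if h : p < n then (α ⟨p, h⟩ : WithTop (Fin n)) else ⊤
  existsUnique_pos j := by
    refine ⟨(α.symm j).val, by simp, ?_⟩
    intro p hp
    by_cases h : p < n
    · simp only [h, dite_true, WithTop.coe_inj] at hp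
      simp [← hp]
    · simp [h] at hp

end StarPerm

/-! ## Linearized forests and the Tamari congruence -/

/-- A forest of binary trees with interior vertices labelled in `L`.  The value at `i` is the tree
hanging from root `i`.  The leaves (the `nil`s) are numbered `0, 1, 2, …` from left to right
through the trees of root `0`, root `1`, and so on. -/
abbrev Forest (L : Type) : Type := ℕ → BinaryTree L

namespace Forest

/-- The root of the tree that contains leaf `p`. -/
noncomputable def rootOfLeaf {L : Type} (f : Forest L) (p : ℕ) : ℕ :=
  sInf {i | p < ∑ k ∈ Finset.range (i + 1), (f k).numLeaves}

/-- Add a caret labelled `a` that joins root `i` and root `i + 1`.  The new root is root `i`, and the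
later roots are renumbered. -/
def addCaret {L : Type} (f : Forest L) (i : ℕ) (a : L) : Forest L := fun k =>
  if k < i then f k else if k = i then BinaryTree.node a (f i) (f (i + 1)) else f (k + 1)

/-- The shape of a forest: the labels of all interior vertices are deleted. -/
def delinearize {L : Type} (f : Forest L) : Forest Unit := fun k => (f k).map fun _ => ()

end Forest

namespace StarPerm

/-- The linearized forest `τ(σ)` of a `*`-permutation: start from the forest of single leaves and,
for each concrete symbol `j` in increasing order, add a caret labelled `j` covering the gap between
leaf `p` and leaf `p + 1`, where `p` is the position of `j` in `σ`. -/
noncomputable def forest {n : ℕ} (σ : StarPerm n) : Forest (Fin n) :=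
  (List.finRange n).foldl (fun f j => f.addCaret (f.rootOfLeaf (σ.pos j)) j)
    (fun _ => BinaryTree.nil)

/-- The congruence `∼`: the forests agree after the labels of the interior vertices are deleted. -/
def Sim {n : ℕ} (ρ σ : StarPerm n) : Prop :=
  ρ.forest.delinearize = σ.forest.delinearize

end StarPerm

/-- The Tamari congruence on the symmetric group: the same binary tree after de-linearization. -/
def TamariRel {n : ℕ} (α β : Equiv.Perm (Fin n)) : Prop :=
  (StarPerm.ofPerm α).Sim (StarPerm.ofPerm β)

/-- The Tamari congruence classes of the symmetric group. -/
def tamariClasses (n : ℕ) : Set (Set (Equiv.Perm (Fin n))) :=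
  {D | ∃ α, D = {β | TamariRel β α}}

/-! ## The sets of `*`-permutations with fixed positions of the stars -/

/-- The set `Sₙ'` of the `*`-permutations whose concrete symbols are exactly at the positions in
`A`. -/
def SPrime (n : ℕ) (A : Finset ℕ) : Type :=
  {σ : StarPerm n // ∀ p, σ.toFun p ≠ ⊤ ↔ p ∈ A}

namespace SPrime

/-- Removal of the stars: the concrete symbols, read from left to right. -/
def removeStars {n : ℕ} {A : Finset ℕ} (hA : A.card = n) (σ : SPrime n A) (i : Fin n) : Fin n :=
  (σ.1.toFun (A.orderEmbOfFin hA i)).untop ((σ.2 _).2 (A.orderEmbOfFin_mem hA i))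

theorem coe_removeStars {n : ℕ} {A : Finset ℕ} (hA : A.card = n) (σ : SPrime n A) (i : Fin n) :
    (σ.removeStars hA i : WithTop (Fin n)) = σ.1.toFun (A.orderEmbOfFin hA i) :=
  WithTop.coe_untop _ _

theorem removeStars_injective {n : ℕ} {A : Finset ℕ} (hA : A.card = n) (σ : SPrime n A) :
    Function.Injective (σ.removeStars hA) := by
  intro i i' h
  have h1 := coe_removeStars hA σ i
  have h2 := coe_removeStars hA σ i'
  rw [← h] at h2
  exact (A.orderEmbOfFin hA).injective ((σ.1.existsUnique_pos _).unique h1.symm h2.symm)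

/-- The canonical identification of `Sₙ'` with `Sₙ` by removal of the stars, as a map. -/
noncomputable def toPerm {n : ℕ} {A : Finset ℕ} (hA : A.card = n) (σ : SPrime n A) :
    Equiv.Perm (Fin n) :=
  Equiv.ofBijective (σ.removeStars hA) (removeStars_injective hA σ).bijective_of_finite

/-- The weak Bruhat order on `Sₙ'`, induced from `Sₙ`. -/
def LE' {n : ℕ} {A : Finset ℕ} (hA : A.card = n) (σ ρ : SPrime n A) : Prop :=
  WeakLE (σ.toPerm hA) (ρ.toPerm hA)

/-- The interval with the given bounds in the weak Bruhat order on `Sₙ'`. -/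
def interval {n : ℕ} {A : Finset ℕ} (hA : A.card = n) (bot top : SPrime n A) :
    Set (SPrime n A) :=
  {ρ | LE' hA bot ρ ∧ LE' hA ρ top}

/-- The `∼`-classes in `Sₙ'`. -/
def classes (n : ℕ) (A : Finset ℕ) : Set (Set (SPrime n A)) :=
  {C | ∃ σ : SPrime n A, C = {ρ | ρ.1.Sim σ.1}}

end SPrime

/-! ## The Thompson monoid -/

/-- The defining relations `xᵢ xⱼ = xⱼ₊₁ xᵢ` for `i < j`. -/
inductive ThompsonRel : FreeMonoid ℕ → FreeMonoid ℕ → Prop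
  | rel (i j : ℕ) (h : i < j) :
      ThompsonRel (FreeMonoid.of i * FreeMonoid.of j) (FreeMonoid.of (j + 1) * FreeMonoid.of i)

/-- The Thompson monoid `P₂`. -/
abbrev ThompsonP2 : Type := PresentedMonoid ThompsonRel

/-!
The linearized forest of a `*`-permutation `σ` is decreasing: the caret over gap `a` is a
descendant of the caret over gap `b`, or that caret itself, exactly when `σ(b)` is concrete and is
the largest term from position `a` to position `b` (`StarPerm.desc_forest_iff`).  Write `Below a b`
for this relation.  It refers to gaps only and not to labels, so it depends only on the shape of
the forest, and everything is expressed through it.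

The word `x(σ)` records the roots at which the carets are added (`GapsOf.rootOfLeaf_eq_inv`), and
the defining relations of `P₂` say that carets at disjoint places commute; hence words that
represent the same element give forests of the same shape.  Conversely, suppose that the
consecutive symbols `i`, `i + 1` have a larger term between them.  Exchanging them preserves
`Below`, and it changes the word by one defining relation (`below_relabel_swap_iff`,
`mk_word_relabel_swap`).  A `132` pattern whose two smaller symbols are as close in value as
possible consists of such consecutive symbols, so every `σ` is joined by exchanges to a
`132`-avoiding `*`-permutation with the same `Below` relation; this one is unique
(`exists_avoids132`, `eq_of_avoids132`).  Therefore the following are equivalent for `ρ` and `σ`: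
`ρ ∼ σ`, their `Below` relations agree, and their words represent the same element of `P₂`
(`sim_iff_below_iff`, `sim_iff_mk_word_eq`).

The weak order is the containment of inversion sets (`weakLE_iff_inversions_subset`).  A pair in
`Below` forces an inversion or a non-inversion of every member of the class.  In a `132`-avoiding
`*`-permutation every non-inversion comes from such a pair, and in a `231`-avoiding one every
inversion does, so these are the top and the bottom of the class; and since inclusion of `Below`
relations implies equality (`below_iff_of_imp`), everything between them belongs to the class.
Finally, `Below` is determined by the positions of the stars and the `Below` relation of the
permutation that remains after their removal (`SPrime.below_iff`), so a class is a union of Tamari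
classes.  For the statement about `P₂`, inversion sequences are in bijection with words
(`word_injective`, `exists_word_eq`), and `Below` determines the positions of the stars.
-/

/-! ### The weak order as containment of inversion sets -/

/-- The inversions of a permutation, as pairs of positions. -/
def inversions {n : ℕ} (α : Equiv.Perm (Fin n)) : Finset (Fin n × Fin n) :=
  Finset.univ.filter fun p => p.1 < p.2 ∧ α p.2 < α p.1

theorem mem_inversions {n : ℕ} {α : Equiv.Perm (Fin n)} {a b : Fin n} :
    (a, b) ∈ inversions α ↔ a < b ∧ α b < α a := by
  simp [inversions]

/-- Exchanging two consecutive values affects the relative order of no other pair of values. -/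
theorem swap_lt_swap_iff {n : ℕ} {i j u v : Fin n} (hij : j.val = i.val + 1)
    (h1 : ¬ (u = i ∧ v = j)) (h2 : ¬ (u = j ∧ v = i)) :
    Equiv.swap i j u < Equiv.swap i j v ↔ u < v := by
  simp only [Equiv.swap_apply_def]
  simp only [Fin.ext_iff] at h1 h2
  split_ifs <;> simp only [Fin.ext_iff, Fin.lt_def] at * <;> omega

theorem perm_eq_one_of_lt_succ {n : ℕ} {f : Equiv.Perm (Fin n)}
    (h : ∀ i j : Fin n, j.val = i.val + 1 → f i < f j) : f = 1 := by
  have hm : StrictMono f := by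
    cases n with
    | zero => exact fun a => a.elim0
    | succ n => exact Fin.strictMono_iff_lt_succ.2 fun i => h _ _ (by simp)
  have := Subsingleton.elim (hm.orderIsoOfSurjective f f.surjective) (OrderIso.refl (Fin n))
  ext x
  exact congrArg (fun g : Fin n ≃o Fin n => (g x).val) this

/-- An upward step: two consecutive values that stand in increasing order are exchanged. -/
def UpStep {n : ℕ} (α β : Equiv.Perm (Fin n)) : Prop :=
  ∃ i j : Fin n, j.val = i.val + 1 ∧ α.symm i < α.symm j ∧ β = Equiv.swap i j * α

theorem inversions_swap_mul {n : ℕ} {α : Equiv.Perm (Fin n)} {i j : Fin n}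
    (hij : j.val = i.val + 1) (h : α.symm i < α.symm j) :
    inversions (Equiv.swap i j * α) = insert (α.symm i, α.symm j) (inversions α) := by
  ext ⟨a, b⟩
  have hlt : i < j := by rw [Fin.lt_def]; omega
  rw [Finset.mem_insert, mem_inversions, mem_inversions, Equiv.Perm.mul_apply,
    Equiv.Perm.mul_apply, Prod.mk.injEq, Equiv.eq_symm_apply, Equiv.eq_symm_apply]
  by_cases h1 : α a = i ∧ α b = j
  · obtain ⟨rfl, rfl⟩ := h1
    simp_all
  by_cases h2 : α b = i ∧ α a = j
  · obtain ⟨rfl, rfl⟩ := h2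
    simp only [Equiv.symm_apply_apply] at h
    simp [h.not_gt, hlt.ne]
  · rw [swap_lt_swap_iff hij h2 (fun h => h1 h.symm)]
    tauto

theorem UpStep.inversions_subset {n : ℕ} {α β : Equiv.Perm (Fin n)} (h : UpStep α β) :
    inversions α ⊆ inversions β := by
  obtain ⟨i, j, hij, h, rfl⟩ := h
  rw [inversions_swap_mul hij h]
  exact Finset.subset_insert _ _

theorem UpStep.card_inversions {n : ℕ} {α β : Equiv.Perm (Fin n)} (h : UpStep α β) :
    (inversions β).card = (inversions α).card + 1 := by
  obtain ⟨i, j, hij, h, rfl⟩ := h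
  have hlt : i < j := by rw [Fin.lt_def]; omega
  rw [inversions_swap_mul hij h, Finset.card_insert_of_notMem]
  simp [mem_inversions, hlt.not_gt]

/-- Left multiplication by a standard reflection is a step up or a step down. -/
theorem IsStandardReflection.upStep_or {n : ℕ} {s : Equiv.Perm (Fin n)}
    (hs : IsStandardReflection s) (α : Equiv.Perm (Fin n)) :
    UpStep α (s * α) ∨ UpStep (s * α) α := by
  obtain ⟨i, j, hij, rfl⟩ := hs
  have hne : i ≠ j := by rw [Ne, Fin.ext_iff]; omega
  rcases lt_or_gt_of_ne (α.symm.injective.ne hne) with h | h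
  · exact Or.inl ⟨i, j, hij, h, rfl⟩
  · refine Or.inr ⟨i, j, hij, ?_, ?_⟩
    · have e (x : Fin n) : (Equiv.swap i j * α).symm x = α.symm (Equiv.swap i j x) := by
        rw [Equiv.symm_apply_eq, Equiv.Perm.mul_apply, Equiv.apply_symm_apply,
          Equiv.swap_apply_self]
      rw [e, e, Equiv.swap_apply_left, Equiv.swap_apply_right]
      exact h
    · rw [← mul_assoc, Equiv.swap_mul_self, one_mul]

/-- If the inversions of `α` are inversions of `β ≠ α`, some two consecutive values that are in
order in `α` are out of order in `β`, for otherwise `β * α⁻¹` would be increasing. -/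
theorem exists_upStep_of_inversions_subset {n : ℕ} {α β : Equiv.Perm (Fin n)}
    (h : inversions α ⊆ inversions β) (hne : α ≠ β) :
    ∃ γ, UpStep α γ ∧ inversions γ ⊆ inversions β := by
  by_contra hcon
  refine hne ?_
  suffices β * α⁻¹ = 1 by rw [mul_inv_eq_one] at this; exact this.symm
  refine perm_eq_one_of_lt_succ fun i j hij => ?_
  have hlt : i < j := by rw [Fin.lt_def]; omega
  change β (α.symm i) < β (α.symm j)
  by_contra hβ
  have hβ' : β (α.symm j) < β (α.symm i) :=
    lt_of_le_of_ne (not_lt.1 hβ) fun e => hlt.ne' (α.symm.injective (β.injective e))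
  rcases lt_or_gt_of_ne (α.symm.injective.ne hlt.ne) with h1 | h1
  · refine hcon ⟨_, ⟨i, j, hij, h1, rfl⟩, ?_⟩
    rw [inversions_swap_mul hij h1]
    exact Finset.insert_subset (mem_inversions.2 ⟨h1, hβ'⟩) h
  · have := mem_inversions.1 (h (mem_inversions.2 ⟨h1, by simpa using hlt⟩))
    exact hβ this.2

theorem reflTransGen_upStep {n : ℕ} {α β : Equiv.Perm (Fin n)}
    (h : inversions α ⊆ inversions β) : Relation.ReflTransGen UpStep α β := by
  induction hk : (inversions β).card - (inversions α).card using Nat.strong_induction_on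
    generalizing α with
  | _ k ih =>
    by_cases hne : α = β
    · rw [hne]
    obtain ⟨γ, hγ, hs⟩ := exists_upStep_of_inversions_subset h hne
    refine .head hγ (ih _ ?_ hs rfl)
    have := Finset.card_le_card hs
    have := hγ.card_inversions
    omega

theorem card_inversions_one {n : ℕ} : (inversions (1 : Equiv.Perm (Fin n))).card = 0 := by
  rw [Finset.card_eq_zero, Finset.eq_empty_iff_forall_notMem]
  rintro ⟨a, b⟩ h
  have := mem_inversions.1 h
  exact this.1.not_gt this.2

/-- A chain of upward steps from the identity to `α` is a word for `α` in the standard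
reflections. -/
theorem exists_reflection_word {n : ℕ} (α : Equiv.Perm (Fin n)) :
    ∃ l : List (Equiv.Perm (Fin n)), (∀ s ∈ l, IsStandardReflection s) ∧ l.prod = α ∧
      l.length = (inversions α).card := by
  have h : Relation.ReflTransGen UpStep 1 α := by
    apply reflTransGen_upStep
    rw [Finset.card_eq_zero.1 card_inversions_one]
    exact Finset.empty_subset _
  induction h with
  | refl => exact ⟨[], by simp, rfl, by rw [card_inversions_one]; rfl⟩
  | tail _ hs ih =>
    obtain ⟨l, h1, h2, h3⟩ := ih
    have hc := hs.card_inversions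
    obtain ⟨i, j, hij, -, rfl⟩ := hs
    refine ⟨Equiv.swap i j :: l, ?_, by simp [h2], by simp [h3, hc]⟩
    rintro s hs
    rcases List.mem_cons.1 hs with rfl | hs
    · exact ⟨i, j, hij, rfl⟩
    · exact h1 s hs

theorem permLength_eq_card_inversions {n : ℕ} (α : Equiv.Perm (Fin n)) :
    permLength α = (inversions α).card := by
  refine le_antisymm (Nat.sInf_le (exists_reflection_word α))
    (le_csInf ⟨_, exists_reflection_word α⟩ ?_)
  rintro k ⟨l, h1, rfl, rfl⟩
  induction l with
  | nil => rw [List.prod_nil, card_inversions_one]; rfl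
  | cons s l ih =>
    rw [List.prod_cons, List.length_cons]
    have := ih fun t ht => h1 t (List.mem_cons_of_mem _ ht)
    rcases (h1 s List.mem_cons_self).upStep_or l.prod with h | h <;>
      have := h.card_inversions <;> omega

theorem weakCover_iff_upStep {n : ℕ} {α β : Equiv.Perm (Fin n)} :
    WeakCover α β ↔ UpStep α β := by
  constructor
  · rintro ⟨s, hs, rfl, hlt⟩
    rw [permLength_eq_card_inversions, permLength_eq_card_inversions] at hlt
    rcases hs.upStep_or α with h | h
    · exact h
    · have := h.card_inversions
      omega
  · intro h
    have hc := h.card_inversions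
    obtain ⟨i, j, hij, -, rfl⟩ := h
    refine ⟨_, ⟨i, j, hij, rfl⟩, rfl, ?_⟩
    rw [permLength_eq_card_inversions, permLength_eq_card_inversions]
    omega

theorem weakLE_iff_inversions_subset {n : ℕ} {α β : Equiv.Perm (Fin n)} :
    WeakLE α β ↔ inversions α ⊆ inversions β := by
  constructor
  · intro h
    induction h with
    | refl => exact subset_rfl
    | tail _ hs ih => exact ih.trans (weakCover_iff_upStep.1 hs).inversions_subset
  · intro h
    exact Relation.ReflTransGen.mono (fun _ _ => weakCover_iff_upStep.2) _ _ (reflTransGen_upStep h)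

/-! ### Positions of the concrete symbols -/

namespace StarPerm

variable {n : ℕ}

theorem pos_eq_iff {σ : StarPerm n} {j : Fin n} {p : ℕ} :
    σ.pos j = p ↔ σ.toFun p = (j : WithTop (Fin n)) :=
  ⟨fun h => h ▸ σ.toFun_pos j, fun h => (σ.existsUnique_pos j).unique (σ.toFun_pos j) h⟩

theorem exists_pos_eq {σ : StarPerm n} {p : ℕ} (h : σ.toFun p ≠ ⊤) : ∃ j, σ.pos j = p := by
  obtain ⟨j, hj⟩ := WithTop.ne_top_iff_exists.1 h
  exact ⟨j, pos_eq_iff.2 hj.symm⟩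

theorem pos_injective (σ : StarPerm n) : Function.Injective σ.pos := fun i j h => by
  have := σ.toFun_pos i
  rw [h, toFun_pos, WithTop.coe_inj] at this
  exact this.symm

theorem toFun_injOn {σ : StarPerm n} {a b : ℕ} (h : σ.toFun a = σ.toFun b)
    (ha : σ.toFun a ≠ ⊤) : a = b := by
  obtain ⟨j, rfl⟩ := exists_pos_eq ha
  rw [toFun_pos] at h
  exact pos_eq_iff.2 h.symm

theorem ext_toFun {σ ρ : StarPerm n} (h : ∀ p, σ.toFun p = ρ.toFun p) : σ = ρ := by
  cases σ
  cases ρ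
  congr
  exact funext h

theorem ext_pos {σ ρ : StarPerm n} (h : ∀ j, σ.pos j = ρ.pos j) : σ = ρ := by
  refine ext_toFun fun p => ?_
  by_cases h1 : σ.toFun p = ⊤
  · rw [h1]
    by_contra h2
    obtain ⟨j, rfl⟩ := exists_pos_eq (Ne.symm h2)
    rw [← h, toFun_pos] at h1
    exact WithTop.coe_ne_top h1
  · obtain ⟨j, rfl⟩ := exists_pos_eq h1
    rw [toFun_pos, h, toFun_pos]

open Classical in
/-- The `*`-permutation whose concrete symbols stand at prescribed distinct positions. -/
noncomputable def ofPos (f : Fin n → ℕ) (hf : Function.Injective f) : StarPerm n where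
  toFun p := if h : ∃ j, f j = p then (h.choose : WithTop (Fin n)) else ⊤
  existsUnique_pos j := by
    refine ⟨f j, ?_, fun p hp => ?_⟩
    · have h : ∃ i, f i = f j := ⟨j, rfl⟩
      simp only [dif_pos h]
      rw [hf h.choose_spec]
    · by_cases h : ∃ i, f i = p
      · simp only [dif_pos h, WithTop.coe_inj] at hp
        rw [← hp, h.choose_spec]
      · simp [dif_neg h] at hp

theorem pos_ofPos (f : Fin n → ℕ) (hf : Function.Injective f) (j : Fin n) :
    (ofPos f hf).pos j = f j := by
  rw [pos_eq_iff]
  have h : ∃ i, f i = f j := ⟨j, rfl⟩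
  simp only [ofPos, dif_pos h]
  rw [hf h.choose_spec]

/-! ### Inversion sequences -/

/-- The inversion number of `j` counts the positions to the left of `j` that are not occupied by a
smaller symbol. -/
theorem inv_eq_count (σ : StarPerm n) (j : Fin n) :
    open Classical in σ.inv j = Nat.count (fun p => ∀ i < j, σ.pos i ≠ p) (σ.pos j) := by
  classical
  rw [Nat.count_eq_card_filter_range, inv]
  congr 1
  refine Finset.filter_congr fun p hp => ?_
  have hp : p < σ.pos j := Finset.mem_range.1 hp
  constructor
  · rintro h i hi rfl
    rw [toFun_pos, WithTop.coe_lt_coe] at h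
    exact h.not_gt hi
  · intro h
    by_contra hlt
    have hne : σ.toFun p ≠ ⊤ := fun e => hlt (e ▸ WithTop.coe_lt_top j)
    obtain ⟨i, rfl⟩ := exists_pos_eq hne
    rw [toFun_pos, WithTop.coe_lt_coe, not_lt] at hlt
    rcases hlt.lt_or_eq with h1 | rfl
    · exact h i h1 rfl
    · exact hp.false

theorem pos_eq_nth (σ : StarPerm n) (j : Fin n) :
    σ.pos j = Nat.nth (fun p => ∀ i < j, σ.pos i ≠ p) (σ.inv j) := by
  classical
  rw [inv_eq_count, Nat.nth_count]
  exact fun i hi h => hi.ne (σ.pos_injective h)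

/-- Each symbol is the `inv j`-th (counted from `0`) of the positions not occupied by smaller
symbols, so the inversion numbers determine the positions recursively. -/
theorem ext_inv {σ ρ : StarPerm n} (h : ∀ j, σ.inv j = ρ.inv j) : σ = ρ := by
  refine ext_pos fun j => ?_
  induction j using WellFoundedLT.induction with
  | _ j ih =>
    rw [pos_eq_nth, pos_eq_nth ρ, h]
    congr 1
    ext p
    exact forall₂_congr fun i hi => by rw [ih i hi]

theorem word_injective : Function.Injective (word : StarPerm n → FreeMonoid ℕ) := by
  intro σ ρ h
  refine ext_inv fun j => ?_
  exact congrFun (List.ofFn_injective (FreeMonoid.ofList.injective h)) j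

theorem length_word (σ : StarPerm n) : σ.word.length = n :=
  List.length_ofFn

/-- The positions of the symbols prescribed by a sequence of inversion numbers. -/
noncomputable def posOfInv (w : ℕ → ℕ) (j : ℕ) : ℕ :=
  Nat.nth (fun p => ∀ i : Fin j, posOfInv w i ≠ p) (w j)
termination_by j
decreasing_by exact i.2

theorem infinite_free_positions (w : ℕ → ℕ) (j : ℕ) :
    (Set.ofPred fun p => ∀ i : Fin j, posOfInv w i ≠ p).Infinite := by
  have : (Set.ofPred fun p => ∀ i : Fin j, posOfInv w i ≠ p) =
      (Set.range fun i : Fin j => posOfInv w i)ᶜ := by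
    ext p
    simp [Set.mem_ofPred_eq]
  rw [this]
  exact (Set.finite_range _).infinite_compl

theorem posOfInv_injective (w : ℕ → ℕ) : Function.Injective (posOfInv w) := by
  have key (i j : ℕ) (h : i < j) : posOfInv w i ≠ posOfInv w j := by
    have := Nat.nth_mem_of_infinite (infinite_free_positions w j) (w j) ⟨i, h⟩
    rw [posOfInv.eq_def w j]
    exact this
  intro i j h
  by_contra hne
  rcases lt_or_gt_of_ne hne with h1 | h1
  · exact key i j h1 h
  · exact key j i h1 h.symm

theorem exists_inv_eq (w : Fin n → ℕ) : ∃ σ : StarPerm n, ∀ j, σ.inv j = w j := by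
  classical
  let w' : ℕ → ℕ := fun j => if h : j < n then w ⟨j, h⟩ else 0
  refine ⟨ofPos (fun j => posOfInv w' j)
    ((posOfInv_injective w').comp Fin.val_injective), fun j => ?_⟩
  rw [inv_eq_count]
  simp only [pos_ofPos]
  have hw : w j = w' j := by simp [w']
  rw [posOfInv.eq_def w' j, hw]
  have hp : (fun p => ∀ i : Fin n, i < j → posOfInv w' i ≠ p) =
      fun p => ∀ i : Fin (j : ℕ), posOfInv w' i ≠ p := by
    ext p
    exact ⟨fun h i => h ⟨i, i.2.trans j.2⟩ i.2, fun h i hi => h ⟨i, hi⟩⟩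
  simp only [hp]
  exact Nat.count_nth_of_infinite (infinite_free_positions w' j) _

theorem exists_word_eq (w : FreeMonoid ℕ) : ∃ σ : StarPerm w.length, σ.word = w := by
  obtain ⟨σ, hσ⟩ := exists_inv_eq fun j : Fin w.length => (FreeMonoid.toList w).get j
  refine ⟨σ, ?_⟩
  rw [word, funext hσ]
  exact congrArg FreeMonoid.ofList (List.ofFn_get _)

end StarPerm

/-! ### The descent relation of the decreasing forest -/

namespace StarPerm

variable {n : ℕ}

/-- The concrete symbol at position `b` is at least every term from position `a` to position `b`.
In the linearized forest this says that the caret over gap `a` is the caret over gap `b` or one of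
its descendants. -/
def Below (σ : StarPerm n) (a b : ℕ) : Prop :=
  σ.toFun b ≠ ⊤ ∧ ∀ c ∈ Set.uIcc a b, σ.toFun c ≤ σ.toFun b

theorem below_self_iff {σ : StarPerm n} {a : ℕ} : σ.Below a a ↔ σ.toFun a ≠ ⊤ := by
  simp [Below]

theorem Below.mono {σ : StarPerm n} {a b c : ℕ} (h : σ.Below a b) (hc : c ∈ Set.uIcc a b) :
    σ.Below c b :=
  ⟨h.1, fun d hd => h.2 d (by rw [Set.mem_uIcc] at *; omega)⟩

theorem Below.le {σ : StarPerm n} {a b : ℕ} (h : σ.Below a b) : σ.toFun a ≤ σ.toFun b :=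
  h.2 a Set.left_mem_uIcc

theorem Below.lt {σ : StarPerm n} {a b : ℕ} (h : σ.Below a b) (hne : a ≠ b) :
    σ.toFun a < σ.toFun b :=
  lt_of_le_of_ne h.le fun e => hne (toFun_injOn e (e ▸ h.1))

theorem Avoids132.below {σ : StarPerm n} (hσ : σ.Avoids132) {a b : ℕ} (hab : a < b)
    (hb : σ.toFun b ≠ ⊤) (h : σ.toFun a < σ.toFun b) : σ.Below a b := by
  refine ⟨hb, fun c hc => ?_⟩
  rw [Set.uIcc_of_le hab.le] at hc
  by_contra hlt
  rw [not_le] at hlt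
  refine hσ ⟨a, c, b, lt_of_le_of_ne hc.1 ?_, lt_of_le_of_ne hc.2 ?_, h, hlt⟩
  · rintro rfl
    exact h.not_gt hlt
  · rintro rfl
    exact hlt.false

theorem Avoids231.below {σ : StarPerm n} (hσ : σ.Avoids231) {a b : ℕ} (hab : a < b)
    (ha : σ.toFun a ≠ ⊤) (h : σ.toFun b < σ.toFun a) : σ.Below b a := by
  refine ⟨ha, fun c hc => ?_⟩
  rw [Set.uIcc_of_ge hab.le] at hc
  by_contra hlt
  rw [not_le] at hlt
  refine hσ ⟨a, c, b, lt_of_le_of_ne hc.1 ?_, lt_of_le_of_ne hc.2 ?_, h, hlt⟩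
  · rintro rfl
    exact hlt.false
  · rintro rfl
    exact h.not_gt hlt

/-- Inclusion of descent relations implies equality: the largest term between two positions is
determined by the descent relation. -/
theorem below_iff_of_imp {σ ρ : StarPerm n} (hA : ∀ p, σ.toFun p = ⊤ ↔ ρ.toFun p = ⊤)
    (h : ∀ a b, σ.Below a b → ρ.toFun a ≤ ρ.toFun b) (a b : ℕ) :
    σ.Below a b ↔ ρ.Below a b := by
  constructor
  · intro hb
    exact ⟨fun e => hb.1 ((hA b).2 e), fun c hc => h c b (hb.mono hc)⟩
  · intro hb
    obtain ⟨m, hm, hmax⟩ := Finset.exists_max_image (Finset.uIcc a b) σ.toFun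
      ⟨a, Finset.left_mem_uIcc⟩
    have hc : ∀ c, c ∈ Finset.uIcc a b ↔ c ∈ Set.uIcc a b := fun c => by
      rw [← Finset.coe_uIcc, Finset.mem_coe]
    have htop : σ.toFun m ≠ ⊤ := by
      intro e
      have := hb.2 m ((hc m).1 hm)
      rw [(hA m).1 e, top_le_iff] at this
      exact hb.1 this
    have hbm : σ.Below b m := by
      refine ⟨htop, fun c hcm => hmax c ((hc c).2 ?_)⟩
      rw [hc, Set.mem_uIcc] at hm
      rw [Set.mem_uIcc] at *
      omega
    have : b = m := toFun_injOn (le_antisymm (h b m hbm) (hb.2 m ((hc m).1 hm))) hb.1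
    subst this
    exact ⟨htop, fun c h => hmax c ((hc c).2 h)⟩

theorem eq_of_avoids132 {σ ρ : StarPerm n} (h : ∀ a b, σ.Below a b ↔ ρ.Below a b)
    (hσ : σ.Avoids132) (hρ : ρ.Avoids132) : σ = ρ := by
  have htop (i : Fin n) : ρ.toFun (σ.pos i) ≠ ⊤ := by
    rw [← below_self_iff, ← h, below_self_iff, toFun_pos]
    exact WithTop.coe_ne_top
  have hval (i : Fin n) : ((ρ.toFun (σ.pos i)).untop (htop i) : WithTop (Fin n)) =
    ρ.toFun (σ.pos i) := WithTop.coe_untop _ _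
  have hinj : Function.Injective fun i => (ρ.toFun (σ.pos i)).untop (htop i) := by
    intro i j hij
    have hij := congrArg (WithTop.some) hij
    simp only [hval] at hij
    exact σ.pos_injective (toFun_injOn hij (htop i))
  have key := perm_eq_one_of_lt_succ
    (f := Equiv.ofBijective _ hinj.bijective_of_finite) fun i j hij => by
      have hlt : i < j := by rw [Fin.lt_def]; omega
      have hσlt : σ.toFun (σ.pos i) < σ.toFun (σ.pos j) := by
        rw [toFun_pos, toFun_pos, WithTop.coe_lt_coe]
        exact hlt
      have hσtop : σ.toFun (σ.pos j) ≠ ⊤ := by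
        rw [toFun_pos]
        exact WithTop.coe_ne_top
      change (ρ.toFun (σ.pos i)).untop _ < (ρ.toFun (σ.pos j)).untop _
      rw [← WithTop.coe_lt_coe, hval, hval]
      rcases lt_or_gt_of_ne (σ.pos_injective.ne hlt.ne) with h1 | h1
      · exact ((h _ _).1 (hσ.below h1 hσtop hσlt)).lt h1.ne
      · by_contra hcon
        have hcon := lt_of_le_of_ne (not_lt.1 hcon) fun e => h1.ne (toFun_injOn e (htop j))
        exact ((h _ _).2 (hρ.below h1 (htop i) hcon)).le.not_gt hσlt
  refine ext_pos fun i => (pos_eq_iff.2 ?_).symm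
  rw [← hval]
  exact congrArg WithTop.some (DFunLike.congr_fun key i)

/-! ### Exchanging consecutive symbols -/

/-- The `*`-permutation with the concrete symbols relabelled by a permutation. -/
def relabel (σ : StarPerm n) (s : Equiv.Perm (Fin n)) : StarPerm n where
  toFun p := (σ.toFun p).map s
  existsUnique_pos j := by
    obtain ⟨p, hp, hu⟩ := σ.existsUnique_pos (s.symm j)
    refine ⟨p, by simp [hp], fun q hq => hu q ?_⟩
    cases h : σ.toFun q with
    | top => simp [h] at hq
    | coe i =>
      simp only [h, WithTop.map_coe, WithTop.coe_inj] at hq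
      simpa [← hq] using h

theorem toFun_relabel (σ : StarPerm n) (s : Equiv.Perm (Fin n)) (p : ℕ) :
    (σ.relabel s).toFun p = (σ.toFun p).map s := rfl

theorem toFun_relabel_eq_top {σ : StarPerm n} {s : Equiv.Perm (Fin n)} {p : ℕ} :
    (σ.relabel s).toFun p = ⊤ ↔ σ.toFun p = ⊤ :=
  WithTop.map_eq_top_iff

theorem pos_relabel (σ : StarPerm n) (s : Equiv.Perm (Fin n)) (j : Fin n) :
    (σ.relabel s).pos (s j) = σ.pos j := by
  rw [pos_eq_iff, toFun_relabel, toFun_pos, WithTop.map_coe]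

theorem relabel_swap_lt_iff {σ : StarPerm n} {i j : Fin n} (hij : j.val = i.val + 1) {a b : ℕ}
    (h1 : ¬ (a = σ.pos i ∧ b = σ.pos j)) (h2 : ¬ (a = σ.pos j ∧ b = σ.pos i)) :
    (σ.relabel (Equiv.swap i j)).toFun a < (σ.relabel (Equiv.swap i j)).toFun b ↔
      σ.toFun a < σ.toFun b := by
  rw [toFun_relabel, toFun_relabel]
  by_cases ha : σ.toFun a = ⊤
  · simp [ha]
  by_cases hb : σ.toFun b = ⊤
  · obtain ⟨u, rfl⟩ := exists_pos_eq ha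
    simp [hb, toFun_pos, WithTop.coe_lt_top]
  obtain ⟨u, rfl⟩ := exists_pos_eq ha
  obtain ⟨v, rfl⟩ := exists_pos_eq hb
  simp only [σ.pos_injective.eq_iff] at h1 h2
  rw [toFun_pos, toFun_pos, WithTop.map_coe, WithTop.map_coe, WithTop.coe_lt_coe,
    WithTop.coe_lt_coe, swap_lt_swap_iff hij h1 h2]

/-- A larger term between two consecutive symbols keeps either of them from being a descendant of
the other, so exchanging them preserves the descent relation. -/
theorem below_relabel_swap_iff {σ : StarPerm n} {i j : Fin n} (hij : j.val = i.val + 1) {m : ℕ}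
    (hm : m ∈ Set.uIcc (σ.pos i) (σ.pos j)) (hlt : (j : WithTop (Fin n)) < σ.toFun m)
    (a b : ℕ) : (σ.relabel (Equiv.swap i j)).Below a b ↔ σ.Below a b := by
  have hlt' : i < j := by rw [Fin.lt_def]; omega
  have hmi : m ≠ σ.pos i := by
    rintro rfl
    rw [toFun_pos, WithTop.coe_lt_coe] at hlt
    exact hlt.not_gt hlt'
  have hmj : m ≠ σ.pos j := by
    rintro rfl
    rw [toFun_pos] at hlt
    exact hlt.false
  by_cases hpair : ∃ c ∈ Set.uIcc a b, (b = σ.pos i ∧ c = σ.pos j) ∨ (b = σ.pos j ∧ c = σ.pos i)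
  · obtain ⟨c, hc, hbc⟩ := hpair
    have hmem : m ∈ Set.uIcc a b := by
      rw [Set.mem_uIcc] at *
      omega
    have h1 : σ.toFun b < σ.toFun m := by
      rcases hbc with ⟨rfl, -⟩ | ⟨rfl, -⟩ <;> rw [toFun_pos]
      · exact (WithTop.coe_lt_coe.2 hlt').trans hlt
      · exact hlt
    have h2 := (relabel_swap_lt_iff hij (fun h => hmj h.2) (fun h => hmi h.2)).2 h1
    exact ⟨fun h => absurd h2 (h.2 m hmem).not_gt, fun h => absurd h1 (h.2 m hmem).not_gt⟩
  · push Not at hpair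
    refine and_congr toFun_relabel_eq_top.not (forall₂_congr fun c hc => ?_)
    rw [← not_lt, ← not_lt, relabel_swap_lt_iff hij]
    · exact fun h => (hpair c hc).1 h.1 h.2
    · exact fun h => (hpair c hc).2 h.1 h.2

/-- The two smaller symbols of an occurrence of the pattern may be taken to be consecutive. -/
theorem exists_consecutive_of_pattern {r : ℕ → ℕ → Prop} [IsStrictTotalOrder ℕ r] {σ : StarPerm n}
    (h : ∃ a b c, r a b ∧ r b c ∧ σ.toFun a < σ.toFun c ∧ σ.toFun c < σ.toFun b) :
    ∃ (i j : Fin n) (b : ℕ), j.val = i.val + 1 ∧ r (σ.pos i) b ∧ r b (σ.pos j) ∧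
      (j : WithTop (Fin n)) < σ.toFun b := by
  have h' : ∃ (d : ℕ) (i j : Fin n) (b : ℕ), d = j.val - i.val ∧ i < j ∧ r (σ.pos i) b ∧
      r b (σ.pos j) ∧ (j : WithTop (Fin n)) < σ.toFun b := by
    obtain ⟨a, b, c, hab, hbc, h1, h2⟩ := h
    obtain ⟨j, rfl⟩ := exists_pos_eq h2.ne_top
    obtain ⟨i, rfl⟩ := exists_pos_eq h1.ne_top
    rw [toFun_pos] at h1 h2
    rw [toFun_pos, WithTop.coe_lt_coe] at h1
    exact ⟨_, i, j, b, rfl, h1, hab, hbc, h2⟩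
  classical
  obtain ⟨i, j, b, hd, hij, hib, hbj, hb⟩ := Nat.find_spec h'
  refine ⟨i, j, b, ?_, hib, hbj, hb⟩
  by_contra hne
  rw [Fin.lt_def] at hij
  -- An intermediate value stands on one side of `b` and gives a pattern with a smaller difference.
  let k : Fin n := ⟨i.val + 1, by omega⟩
  have hkj : k < j := by simp only [k, Fin.lt_def]; omega
  have hk : (k : WithTop (Fin n)) < σ.toFun b := (WithTop.coe_lt_coe.2 hkj).trans hb
  rcases trichotomous_of r (σ.pos k) b with h1 | h1 | h1
  · refine Nat.find_min h' (m := j.val - k.val) ?_ ⟨k, j, b, rfl, hkj, h1, hbj, hb⟩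
    simp only [k]
    omega
  · rw [← h1, toFun_pos] at hk
    exact hk.false
  · refine Nat.find_min h' (m := k.val - i.val) ?_ ⟨i, k, b, rfl, ?_, hib, h1, hk⟩
    · simp only [k]
      omega
    · simp only [k, Fin.lt_def]
      omega

end StarPerm

namespace StarPerm

variable {n : ℕ}

/-- As long as a `*`-permutation contains the pattern, two consecutive symbols on the two sides of
a larger term can be exchanged; this decreases the number of pairs of symbols in increasing order
with respect to `r`, so that the pattern is eventually avoided.  With `<` and `>` for `r` the
pattern is `132` and `231`. -/
theorem exists_avoiding {r : ℕ → ℕ → Prop} [IsStrictTotalOrder ℕ r]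
    {P : StarPerm n → Prop} (σ : StarPerm n) (hP : P σ)
    (step : ∀ (ρ : StarPerm n) (i j : Fin n) (b : ℕ), P ρ → j.val = i.val + 1 →
      r (ρ.pos i) b → r b (ρ.pos j) → (j : WithTop (Fin n)) < ρ.toFun b →
      P (ρ.relabel (Equiv.swap i j))) :
    ∃ ρ, P ρ ∧
      ¬ ∃ a b c, r a b ∧ r b c ∧ ρ.toFun a < ρ.toFun c ∧ ρ.toFun c < ρ.toFun b := by
  classical
  obtain ⟨A, hA⟩ : ∃ A : Finset ℕ, ∀ p, σ.toFun p ≠ ⊤ → p ∈ A := by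
    refine ⟨Finset.univ.image σ.pos, fun p hp => ?_⟩
    obtain ⟨j, rfl⟩ := exists_pos_eq hp
    exact Finset.mem_image_of_mem _ (Finset.mem_univ j)
  induction hk : ((A ×ˢ A).filter fun p => r p.1 p.2 ∧ σ.toFun p.1 < σ.toFun p.2).card using
    Nat.strong_induction_on generalizing σ with
  | _ k ih =>
    by_cases hpat : ∃ a b c, r a b ∧ r b c ∧ σ.toFun a < σ.toFun c ∧ σ.toFun c < σ.toFun b
    · obtain ⟨i, j, b, hij, hib, hbj, hb⟩ := exists_consecutive_of_pattern hpat
      refine ih _ ?_ (σ.relabel (Equiv.swap i j)) (step σ i j b hP hij hib hbj hb)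
        (fun p hp => hA p (toFun_relabel_eq_top.not.1 hp)) rfl
      have hlt : i < j := by rw [Fin.lt_def]; omega
      have hr : r (σ.pos i) (σ.pos j) := trans_of r hib hbj
      rw [← hk]
      refine Finset.card_lt_card ((Finset.ssubset_iff_of_subset ?_).2
        ⟨(σ.pos i, σ.pos j), ?_, ?_⟩)
      · rintro ⟨a, c⟩ hac
        simp only [Finset.mem_filter] at hac ⊢
        refine ⟨hac.1, hac.2.1, (relabel_swap_lt_iff hij ?_ ?_).1 hac.2.2⟩
        · rintro ⟨rfl, rfl⟩
          have := hac.2.2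
          simp only [toFun_relabel, toFun_pos, WithTop.map_coe, Equiv.swap_apply_left,
            Equiv.swap_apply_right, WithTop.coe_lt_coe] at this
          exact this.not_gt hlt
        · rintro ⟨rfl, rfl⟩
          exact asymm_of r hr hac.2.1
      · simp only [Finset.mem_filter, Finset.mem_product, toFun_pos, WithTop.coe_lt_coe]
        exact ⟨⟨hA _ (by simp [toFun_pos]), hA _ (by simp [toFun_pos])⟩, hr, hlt⟩
      · rw [Finset.mem_filter, toFun_relabel, toFun_relabel, toFun_pos, toFun_pos,
          WithTop.map_coe, WithTop.map_coe, Equiv.swap_apply_left, Equiv.swap_apply_right,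
          WithTop.coe_lt_coe]
        exact fun h => h.2.2.not_gt hlt
    · exact ⟨σ, hP, hpat⟩

theorem exists_avoids231 (σ : StarPerm n) :
    ∃ ρ : StarPerm n, (∀ a b, ρ.Below a b ↔ σ.Below a b) ∧ ρ.Avoids231 := by
  obtain ⟨ρ, h1, h2⟩ := exists_avoiding (r := (· > ·))
    (P := fun ρ => ∀ a b, ρ.Below a b ↔ σ.Below a b) σ (fun _ _ => Iff.rfl)
    fun ρ i j b hP hij hib hbj hb a c => by
      rw [below_relabel_swap_iff hij (m := b) (by rw [Set.mem_uIcc]; omega) hb, hP]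
  exact ⟨ρ, h1, fun ⟨a, b, c, hab, hbc, h3, h4⟩ => h2 ⟨c, b, a, hbc, hab, h3, h4⟩⟩

/-! ### The exchange as a defining relation of the Thompson monoid -/

theorem inv_relabel_swap_of_ne {σ : StarPerm n} {i j u : Fin n} (hij : j.val = i.val + 1)
    (hi : u ≠ i) (hj : u ≠ j) : (σ.relabel (Equiv.swap i j)).inv u = σ.inv u := by
  have hs : Equiv.swap i j u = u := Equiv.swap_apply_of_ne_of_ne hi hj
  have hpos : (σ.relabel (Equiv.swap i j)).pos u = σ.pos u := by
    conv_lhs => rw [← hs]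
    exact pos_relabel _ _ _
  rw [inv, inv, hpos]
  congr 1
  refine Finset.filter_congr fun p _ => ?_
  have h1 : (u : WithTop (Fin n)) = (σ.relabel (Equiv.swap i j)).toFun (σ.pos u) := by
    rw [toFun_relabel, toFun_pos, WithTop.map_coe, hs]
  conv_lhs => rw [h1]
  rw [relabel_swap_lt_iff hij (fun h => hi (σ.pos_injective h.1))
    (fun h => hj (σ.pos_injective h.1)), toFun_pos]

theorem coe_lt_iff_of_succ {i j : Fin n} (hij : j.val = i.val + 1) {x : WithTop (Fin n)} :
    (i : WithTop (Fin n)) < x ↔ x = j ∨ (j : WithTop (Fin n)) < x := by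
  cases x with
  | top => simp [WithTop.coe_lt_top]
  | coe x =>
    rw [WithTop.coe_lt_coe, WithTop.coe_lt_coe, WithTop.coe_inj, Fin.lt_def, Fin.lt_def,
      Fin.ext_iff]
    omega

theorem lt_map_swap_iff {i j : Fin n} (hij : j.val = i.val + 1) {x : WithTop (Fin n)} :
    (j : WithTop (Fin n)) < x.map (Equiv.swap i j) ↔ (j : WithTop (Fin n)) < x := by
  cases x with
  | top => simp
  | coe x =>
    rw [WithTop.map_coe, WithTop.coe_lt_coe, WithTop.coe_lt_coe, Equiv.swap_apply_def]
    split_ifs <;> simp only [Fin.lt_def, Fin.ext_iff] at * <;> omega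

theorem map_swap_eq_iff {i j : Fin n} {x : WithTop (Fin n)} :
    x.map (Equiv.swap i j) = j ↔ x = i := by
  cases x with
  | top => simp
  | coe x =>
    rw [WithTop.map_coe, WithTop.coe_inj, WithTop.coe_inj, Equiv.swap_apply_eq_iff,
      Equiv.swap_apply_right]

theorem inv_relabel_swap_right {σ : StarPerm n} {i j : Fin n} (hij : j.val = i.val + 1)
    (h : σ.pos i < σ.pos j) : (σ.relabel (Equiv.swap i j)).inv j = σ.inv i := by
  have hpos : (σ.relabel (Equiv.swap i j)).pos j = σ.pos i := by
    have := pos_relabel σ (Equiv.swap i j) i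
    rwa [Equiv.swap_apply_left] at this
  rw [inv, inv, hpos]
  congr 1
  refine Finset.filter_congr fun p hp => ?_
  rw [toFun_relabel, lt_map_swap_iff hij, coe_lt_iff_of_succ hij (x := σ.toFun p), ← pos_eq_iff]
  have : σ.pos j ≠ p := (lt_trans (Finset.mem_range.1 hp) h).ne'
  tauto

theorem inv_relabel_swap_left {σ : StarPerm n} {i j : Fin n} (hij : j.val = i.val + 1)
    (h : σ.pos i < σ.pos j) : (σ.relabel (Equiv.swap i j)).inv i = σ.inv j + 1 := by
  have hpos : (σ.relabel (Equiv.swap i j)).pos i = σ.pos j := by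
    have := pos_relabel σ (Equiv.swap i j) j
    rwa [Equiv.swap_apply_right] at this
  have hlt : i < j := by rw [Fin.lt_def]; omega
  rw [inv, inv, hpos, ← Finset.card_insert_of_notMem (a := σ.pos i)]
  · congr 1
    ext p
    rw [Finset.mem_insert, Finset.mem_filter, Finset.mem_filter, Finset.mem_range, toFun_relabel,
      coe_lt_iff_of_succ hij, lt_map_swap_iff hij, map_swap_eq_iff, ← pos_eq_iff]
    constructor
    · rintro ⟨h1, h2 | h2⟩
      · exact Or.inl h2.symm
      · exact Or.inr ⟨h1, h2⟩
    · rintro (rfl | h2)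
      · exact ⟨h, Or.inl rfl⟩
      · exact ⟨h2.1, Or.inr h2.2⟩
  · rw [Finset.mem_filter, toFun_pos, WithTop.coe_lt_coe]
    exact fun h => h.2.not_gt hlt

theorem inv_lt_inv {σ : StarPerm n} {i j : Fin n} (hij : j.val = i.val + 1) {b : ℕ}
    (h1 : σ.pos i < b) (h2 : b < σ.pos j) (hb : (j : WithTop (Fin n)) < σ.toFun b) :
    σ.inv i < σ.inv j := by
  refine Finset.card_lt_card ((Finset.ssubset_iff_of_subset ?_).2 ⟨b, ?_, ?_⟩)
  · intro p hp
    rw [Finset.mem_filter, Finset.mem_range, coe_lt_iff_of_succ hij, ← pos_eq_iff] at hp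
    rw [Finset.mem_filter, Finset.mem_range]
    refine ⟨by omega, hp.2.resolve_left ?_⟩
    rintro rfl
    omega
  · rw [Finset.mem_filter, Finset.mem_range]
    exact ⟨h2, hb⟩
  · rw [Finset.mem_filter, Finset.mem_range]
    exact fun h => h.1.not_gt h1

theorem ofFn_eq_split {f : Fin n → ℕ} {i j : Fin n} (hij : j.val = i.val + 1) :
    List.ofFn f = (List.ofFn f).take i ++ ([f i, f j] ++ (List.ofFn f).drop (i + 2)) := by
  conv_lhs => rw [← List.take_append_drop i (List.ofFn f)]
  have hj := j.2
  rw [List.drop_eq_getElem_cons (by simp), List.drop_eq_getElem_cons (by simp; omega)]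
  simp [← hij]
  omega

theorem mk_word_relabel_swap {σ : StarPerm n} {i j : Fin n} (hij : j.val = i.val + 1) {b : ℕ}
    (h1 : σ.pos i < b) (h2 : b < σ.pos j) (hb : (j : WithTop (Fin n)) < σ.toFun b) :
    PresentedMonoid.mk ThompsonRel (σ.relabel (Equiv.swap i j)).word =
      PresentedMonoid.mk ThompsonRel σ.word := by
  have key (ρ : StarPerm n) : ρ.word = FreeMonoid.ofList ((List.ofFn ρ.inv).take i) *
      ((FreeMonoid.of (ρ.inv i) * FreeMonoid.of (ρ.inv j)) *
        FreeMonoid.ofList ((List.ofFn ρ.inv).drop (i + 2))) :=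
    congrArg FreeMonoid.ofList (ofFn_eq_split hij)
  have hne {u : Fin n} (h3 : u.val ≠ i) (h4 : u.val ≠ i + 1) :
      (σ.relabel (Equiv.swap i j)).inv u = σ.inv u :=
    inv_relabel_swap_of_ne hij (fun h => h3 (congrArg _ h))
      (fun h => h4 ((congrArg _ h).trans hij))
  have htake : (List.ofFn (σ.relabel (Equiv.swap i j)).inv).take i =
      (List.ofFn σ.inv).take i := by
    refine List.ext_getElem (by simp) fun k h3 _ => ?_
    rw [List.length_take, List.length_ofFn] at h3
    rw [List.getElem_take, List.getElem_take, List.getElem_ofFn, List.getElem_ofFn]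
    exact hne (by simp only; omega) (by simp only; omega)
  have hdrop : (List.ofFn (σ.relabel (Equiv.swap i j)).inv).drop (i + 2) =
      (List.ofFn σ.inv).drop (i + 2) := by
    refine List.ext_getElem (by simp) fun k h3 _ => ?_
    rw [List.getElem_drop, List.getElem_drop, List.getElem_ofFn, List.getElem_ofFn]
    exact hne (by simp only; omega) (by simp only; omega)
  have hrel : PresentedMonoid.mk ThompsonRel
      (FreeMonoid.of (σ.inv i) * FreeMonoid.of (σ.inv j)) =
      PresentedMonoid.mk ThompsonRel (FreeMonoid.of (σ.inv j + 1) * FreeMonoid.of (σ.inv i)) :=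
    Quotient.sound (s := (conGen ThompsonRel).toSetoid) (ConGen.Rel.of _ _
      (ThompsonRel.rel _ _ (inv_lt_inv hij h1 h2 hb)))
  rw [key σ, key (σ.relabel _), inv_relabel_swap_left hij (h1.trans h2),
    inv_relabel_swap_right hij (h1.trans h2), htake, hdrop, map_mul, map_mul _ (_ * _),
    map_mul (PresentedMonoid.mk ThompsonRel) (FreeMonoid.ofList _) (_ * _),
    map_mul _ (_ * _) (FreeMonoid.ofList _), hrel]

theorem exists_avoids132 (σ : StarPerm n) :
    ∃ ρ : StarPerm n, ((∀ a b, ρ.Below a b ↔ σ.Below a b) ∧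
      PresentedMonoid.mk ThompsonRel ρ.word = PresentedMonoid.mk ThompsonRel σ.word) ∧
      ρ.Avoids132 :=
  exists_avoiding (r := (· < ·)) (P := fun ρ => (∀ a b, ρ.Below a b ↔ σ.Below a b) ∧
      PresentedMonoid.mk ThompsonRel ρ.word = PresentedMonoid.mk ThompsonRel σ.word)
    σ ⟨fun _ _ => Iff.rfl, rfl⟩ fun ρ i j b hP hij hib hbj hb =>
      ⟨fun a c => by
        rw [below_relabel_swap_iff hij (m := b) (by rw [Set.mem_uIcc]; omega) hb, hP.1],
      (mk_word_relabel_swap hij hib hbj hb).trans hP.2⟩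

/-- Both `*`-permutations are joined by exchanges to the one with the same descent relation that
avoids `132`. -/
theorem mk_word_eq_of_below {σ ρ : StarPerm n} (h : ∀ a b, σ.Below a b ↔ ρ.Below a b) :
    PresentedMonoid.mk ThompsonRel σ.word = PresentedMonoid.mk ThompsonRel ρ.word := by
  obtain ⟨σ', ⟨h1, h2⟩, h3⟩ := exists_avoids132 σ
  obtain ⟨ρ', ⟨h4, h5⟩, h6⟩ := exists_avoids132 ρ
  have := eq_of_avoids132 (fun a b => by rw [h1, h4, h]) h3 h6
  rw [← h2, ← h5, this]

end StarPerm

/-! ### Gaps of a forest -/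

namespace Forest

variable {L : Type}

/-- The number of leaves to the left of root `k`, which is also the leftmost leaf of its tree. -/
def offset (f : Forest L) (k : ℕ) : ℕ := ∑ i ∈ Finset.range k, (f i).numLeaves

theorem offset_zero (f : Forest L) : f.offset 0 = 0 := rfl

theorem offset_succ (f : Forest L) (k : ℕ) : f.offset (k + 1) = f.offset k + (f k).numLeaves :=
  Finset.sum_range_succ _ _

theorem offset_strictMono (f : Forest L) : StrictMono f.offset :=
  strictMono_nat_of_lt_succ fun k => by
    have := (f k).numLeaves_pos
    rw [offset_succ]
    omega

theorem rootOfLeaf_eq {f : Forest L} {p i : ℕ} (h1 : f.offset i ≤ p) (h2 : p < f.offset (i + 1)) :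
    f.rootOfLeaf p = i := by
  refine le_antisymm (Nat.sInf_le h2) (le_csInf ⟨i, h2⟩ fun k hk => ?_)
  have := f.offset_strictMono.lt_iff_lt.1 (h1.trans_lt hk)
  omega

theorem offset_addCaret (f : Forest L) (i : ℕ) (x : L) (k : ℕ) :
    (f.addCaret i x).offset k = if k ≤ i then f.offset k else f.offset (k + 1) := by
  induction k with
  | zero => simp [offset_zero]
  | succ k ih =>
    rw [offset_succ, ih, addCaret]
    rcases lt_trichotomy k i with h | rfl | h
    · rw [if_pos h.le, if_pos h, if_pos (Nat.succ_le_of_lt h), offset_succ]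
    · rw [if_pos le_rfl, if_neg (lt_irrefl _), if_pos rfl, if_neg (by omega), offset_succ,
        offset_succ, BinaryTree.numLeaves, add_assoc]
    · rw [if_neg (by omega), if_neg (by omega), if_neg (by omega), if_neg (by omega),
        ← offset_succ]

/-- In a tree with leftmost leaf `o`, the caret over the gap between the leaves `b` and `b + 1` is
the caret over the gap between `a` and `a + 1` or one of its ancestors. -/
def TreeDesc : BinaryTree L → ℕ → ℕ → ℕ → Prop
  | .nil, _, _, _ => False
  | .node _ l r, o, a, b => TreeDesc l o a b ∨ TreeDesc r (o + l.numLeaves) a b ∨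
      (b + 1 = o + l.numLeaves ∧ o ≤ a ∧ a + 1 < o + l.numLeaves + r.numLeaves)

/-- The descent relation on the gaps of a forest that are covered by a caret. -/
def Desc (f : Forest L) (a b : ℕ) : Prop := ∃ k, TreeDesc (f k) (f.offset k) a b

theorem desc_addCaret {f : Forest L} {i : ℕ} {x : L} {a b : ℕ} :
    (f.addCaret i x).Desc a b ↔ f.Desc a b ∨
      (b + 1 = f.offset (i + 1) ∧ f.offset i ≤ a ∧ a + 1 < f.offset (i + 2)) := by
  have hnode : TreeDesc (f.addCaret i x i) ((f.addCaret i x).offset i) a b ↔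
      TreeDesc (f i) (f.offset i) a b ∨ TreeDesc (f (i + 1)) (f.offset (i + 1)) a b ∨
      (b + 1 = f.offset (i + 1) ∧ f.offset i ≤ a ∧ a + 1 < f.offset (i + 2)) := by
    rw [offset_addCaret, if_pos le_rfl, addCaret, if_neg (lt_irrefl _), if_pos rfl, TreeDesc,
      offset_succ f (i + 1), offset_succ]
  have hlt {k : ℕ} (h : k < i) : TreeDesc (f.addCaret i x k) ((f.addCaret i x).offset k) a b ↔
      TreeDesc (f k) (f.offset k) a b := by
    rw [offset_addCaret, if_pos h.le, addCaret, if_pos h]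
  have hgt {k : ℕ} (h : i < k) : TreeDesc (f.addCaret i x k) ((f.addCaret i x).offset k) a b ↔
      TreeDesc (f (k + 1)) (f.offset (k + 1)) a b := by
    rw [offset_addCaret, if_neg (by omega), addCaret, if_neg (by omega), if_neg (by omega)]
  constructor
  · rintro ⟨k, hk⟩
    rcases lt_trichotomy k i with h | rfl | h
    · exact Or.inl ⟨k, (hlt h).1 hk⟩
    · rcases hnode.1 hk with h | h | h
      · exact Or.inl ⟨_, h⟩
      · exact Or.inl ⟨_, h⟩
      · exact Or.inr h
    · exact Or.inl ⟨k + 1, (hgt h).1 hk⟩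
  · rintro (⟨k, hk⟩ | h)
    · rcases lt_trichotomy k i with h | rfl | h
      · exact ⟨k, (hlt h).2 hk⟩
      · exact ⟨k, hnode.2 (Or.inl hk)⟩
      · obtain ⟨k, rfl⟩ : ∃ k', k = k' + 1 := ⟨k - 1, by omega⟩
        rcases (Nat.lt_succ_iff.1 h).lt_or_eq with h | rfl
        · exact ⟨k, (hgt h).2 hk⟩
        · exact ⟨i, hnode.2 (Or.inr (Or.inl hk))⟩
    · exact ⟨i, hnode.2 (Or.inr (Or.inr h))⟩

/-! ### Deletion of the labels -/

theorem numLeaves_map {M : Type} (g : L → M) (t : BinaryTree L) :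
    (t.map g).numLeaves = t.numLeaves := by
  induction t with
  | nil => rfl
  | node x l r hl hr => simp only [BinaryTree.map, BinaryTree.numLeaves, hl, hr]

theorem treeDesc_map {M : Type} (g : L → M) (t : BinaryTree L) (o a b : ℕ) :
    TreeDesc (t.map g) o a b ↔ TreeDesc t o a b := by
  induction t generalizing o with
  | nil => rfl
  | node x l r hl hr => simp only [BinaryTree.map, TreeDesc, numLeaves_map, hl, hr]

theorem desc_delinearize {f : Forest L} {a b : ℕ} : f.delinearize.Desc a b ↔ f.Desc a b := by
  refine exists_congr fun k => ?_
  have : f.delinearize.offset k = f.offset k := Finset.sum_congr rfl fun i _ => numLeaves_map _ _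
  rw [this]
  exact treeDesc_map _ _ _ _ _

theorem delinearize_addCaret (f : Forest L) (i : ℕ) (x : L) :
    (f.addCaret i x).delinearize = f.delinearize.addCaret i () := by
  funext k
  simp only [delinearize, addCaret]
  split_ifs <;> rfl

end Forest

/-! ### The forest of a `*`-permutation -/

namespace StarPerm

variable {n : ℕ}

/-- The linearized forest after the carets of the `m` smallest symbols have been added. -/
noncomputable def partialForest (σ : StarPerm n) (m : ℕ) : Forest (Fin n) :=
  ((List.finRange n).take m).foldl (fun f j => f.addCaret (f.rootOfLeaf (σ.pos j)) j)
    (fun _ => BinaryTree.nil)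

theorem partialForest_zero (σ : StarPerm n) : σ.partialForest 0 = fun _ => BinaryTree.nil := rfl

theorem partialForest_length (σ : StarPerm n) : σ.partialForest n = σ.forest := by
  rw [partialForest, List.take_of_length_le (by simp)]
  rfl

theorem partialForest_succ (σ : StarPerm n) (j : Fin n) :
    σ.partialForest (j + 1) = (σ.partialForest j).addCaret
      ((σ.partialForest j).rootOfLeaf (σ.pos j)) j := by
  rw [partialForest, List.take_add_one]
  simp [partialForest]

/-- The trees of `f` meet exactly at the gaps at which no symbol smaller than `m` stands. -/
def GapsOf (σ : StarPerm n) (m : ℕ) (f : Forest (Fin n)) : Prop :=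
  ∀ q, (∃ k, f.offset k = q + 1) ↔ ¬ ∃ j : Fin n, j.val < m ∧ σ.pos j = q

theorem GapsOf.offset_rootOfLeaf_succ {σ : StarPerm n} {j : Fin n} {f : Forest (Fin n)}
    (h : σ.GapsOf j f) : f.offset (f.rootOfLeaf (σ.pos j) + 1) = σ.pos j + 1 := by
  obtain ⟨k, hk⟩ := (h (σ.pos j)).2 fun ⟨i, hi, e⟩ => by
    rw [σ.pos_injective e] at hi
    exact hi.false
  obtain ⟨i, rfl⟩ : ∃ i, k = i + 1 := by
    refine ⟨k - 1, ?_⟩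
    rcases k with _ | k
    · rw [Forest.offset_zero] at hk
      omega
    · rfl
  have h1 := f.offset_strictMono (Nat.lt_add_one i)
  rw [Forest.rootOfLeaf_eq (i := i) (by omega) (by omega), hk]

theorem GapsOf.addCaret {σ : StarPerm n} {j : Fin n} {f : Forest (Fin n)} (h : σ.GapsOf j f) :
    σ.GapsOf (j + 1) (f.addCaret (f.rootOfLeaf (σ.pos j)) j) := by
  intro q
  have hr := h.offset_rootOfLeaf_succ
  set i := f.rootOfLeaf (σ.pos j)
  have h1 : (∃ k, (f.addCaret i j).offset k = q + 1) ↔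
      (∃ k, f.offset k = q + 1) ∧ q ≠ σ.pos j := by
    constructor
    · rintro ⟨k, hk⟩
      rw [Forest.offset_addCaret] at hk
      split_ifs at hk with hki
      · refine ⟨⟨k, hk⟩, ?_⟩
        rintro rfl
        have := f.offset_strictMono.injective (hk.trans hr.symm)
        omega
      · refine ⟨⟨k + 1, hk⟩, ?_⟩
        rintro rfl
        have := f.offset_strictMono.injective (hk.trans hr.symm)
        omega
    · rintro ⟨⟨k, hk⟩, hq⟩
      have hki : k ≠ i + 1 := by
        rintro rfl
        omega
      rcases le_or_gt k i with h2 | h2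
      · exact ⟨k, by rw [Forest.offset_addCaret, if_pos h2, hk]⟩
      · refine ⟨k - 1, ?_⟩
        rw [Forest.offset_addCaret, if_neg (by omega), Nat.sub_add_cancel (by omega), hk]
  rw [h1, h q]
  constructor
  · rintro ⟨h2, h3⟩ ⟨u, hu, rfl⟩
    rcases (Nat.lt_succ_iff.1 hu).lt_or_eq with h4 | h4
    · exact h2 ⟨u, h4, rfl⟩
    · exact h3 (by rw [Fin.ext h4])
  · intro h2
    refine ⟨fun ⟨u, hu, e⟩ => h2 ⟨u, by omega, e⟩, ?_⟩
    rintro rfl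
    exact h2 ⟨j, by omega, rfl⟩

theorem gapsOf_partialForest (σ : StarPerm n) {m : ℕ} (hm : m ≤ n) :
    σ.GapsOf m (σ.partialForest m) := by
  induction m with
  | zero =>
    intro q
    simp only [not_lt_zero, false_and, exists_false, not_false_eq_true, iff_true]
    exact ⟨q + 1, by simp [partialForest_zero, Forest.offset, BinaryTree.numLeaves]⟩
  | succ m ih =>
    have := partialForest_succ σ ⟨m, hm⟩
    simp only at this
    rw [this]
    exact GapsOf.addCaret (j := ⟨m, hm⟩) (ih (by omega))

theorem GapsOf.exists_offset_eq_iff {σ : StarPerm n} {j : Fin n} {f : Forest (Fin n)}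
    (h : σ.GapsOf j f) {q : ℕ} (hq : q ≠ σ.pos j) :
    (∃ k, f.offset k = q + 1) ↔ (j : WithTop (Fin n)) < σ.toFun q := by
  rw [h q]
  constructor
  · intro h1
    by_contra h2
    have hne : σ.toFun q ≠ ⊤ := fun e => h2 (e ▸ WithTop.coe_lt_top j)
    obtain ⟨i, rfl⟩ := exists_pos_eq hne
    rw [toFun_pos, WithTop.coe_lt_coe, not_lt] at h2
    exact h1 ⟨i, lt_of_le_of_ne h2 fun e => hq (congrArg σ.pos (Fin.ext e)), rfl⟩
  · rintro h1 ⟨i, hi, rfl⟩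
    rw [toFun_pos, WithTop.coe_lt_coe] at h1
    exact h1.not_gt hi

/-- The roots to the left of the new caret are as many as the gaps between trees to its left, and
these are the gaps with a larger term. -/
theorem GapsOf.rootOfLeaf_eq_inv {σ : StarPerm n} {j : Fin n} {f : Forest (Fin n)}
    (h : σ.GapsOf j f) : f.rootOfLeaf (σ.pos j) = σ.inv j := by
  have hr := h.offset_rootOfLeaf_succ
  set i := f.rootOfLeaf (σ.pos j)
  have hpos (k : ℕ) : 0 < f.offset (k + 1) := by
    have := f.offset_strictMono (Nat.succ_pos k)
    rwa [Forest.offset_zero] at this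
  have himg : (Finset.range (σ.pos j)).filter (fun p => (j : WithTop (Fin n)) < σ.toFun p) =
      (Finset.range i).image fun k => f.offset (k + 1) - 1 := by
    ext q
    simp only [Finset.mem_filter, Finset.mem_image, Finset.mem_range]
    constructor
    · rintro ⟨h1, h2⟩
      obtain ⟨k, hk⟩ := (GapsOf.exists_offset_eq_iff h h1.ne).2 h2
      have hk0 : k ≠ 0 := by
        rintro rfl
        rw [Forest.offset_zero] at hk
        omega
      have hki : k < i + 1 := by
        rw [← f.offset_strictMono.lt_iff_lt]
        omega
      refine ⟨k - 1, by omega, ?_⟩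
      rw [Nat.sub_add_cancel (by omega), hk, Nat.add_sub_cancel]
    · rintro ⟨k, hk, rfl⟩
      have h1 := f.offset_strictMono (Nat.succ_lt_succ hk)
      have h2 := hpos k
      simp only [Nat.succ_eq_add_one] at h1
      exact ⟨by omega, (GapsOf.exists_offset_eq_iff h (by omega)).1 ⟨k + 1, by omega⟩⟩
  rw [inv, himg, Finset.card_image_of_injective, Finset.card_range]
  intro k l hkl
  have h1 := hpos k
  have h2 := hpos l
  simp only at hkl
  have := f.offset_strictMono.injective (show f.offset (k + 1) = f.offset (l + 1) by omega)
  omega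

/-- The new caret covers exactly the gaps at which the symbols between them and `j` are at most
`j`. -/
theorem GapsOf.below_pos_iff {σ : StarPerm n} {j : Fin n} {f : Forest (Fin n)}
    (h : σ.GapsOf j f) {a : ℕ} : σ.Below a (σ.pos j) ↔
      f.offset (f.rootOfLeaf (σ.pos j)) ≤ a ∧ a + 1 < f.offset (f.rootOfLeaf (σ.pos j) + 2) := by
  have hr := h.offset_rootOfLeaf_succ
  set i := f.rootOfLeaf (σ.pos j)
  have h1 := f.offset_strictMono (Nat.lt_succ_self i)
  have h2 := f.offset_strictMono (Nat.lt_succ_self (i + 1))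
  simp only [Nat.succ_eq_add_one, add_assoc, one_add_one_eq_two] at h1 h2
  simp only [Below, toFun_pos]
  constructor
  · rintro ⟨-, hb⟩
    constructor
    · by_contra hlt
      refine (hb (f.offset i - 1) (by rw [Set.mem_uIcc]; omega)).not_gt ?_
      exact (GapsOf.exists_offset_eq_iff h (by omega)).1 ⟨i, by omega⟩
    · by_contra hlt
      refine (hb (f.offset (i + 2) - 1) (by rw [Set.mem_uIcc]; omega)).not_gt ?_
      exact (GapsOf.exists_offset_eq_iff h (by omega)).1 ⟨i + 2, by omega⟩
  · rintro ⟨ha1, ha2⟩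
    refine ⟨WithTop.coe_ne_top, fun c hc => ?_⟩
    by_contra hlt
    rw [not_le] at hlt
    have hcj : c ≠ σ.pos j := by
      rintro rfl
      rw [toFun_pos] at hlt
      exact hlt.false
    obtain ⟨k, hk⟩ := (GapsOf.exists_offset_eq_iff h hcj).2 hlt
    rw [Set.mem_uIcc] at hc
    rcases lt_or_gt_of_ne hcj with hc' | hc'
    · have h3 := f.offset_strictMono.lt_iff_lt.1 (show f.offset i < f.offset k by omega)
      have h4 := f.offset_strictMono.lt_iff_lt.1 (show f.offset k < f.offset (i + 1) by omega)
      omega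
    · have h3 := f.offset_strictMono.lt_iff_lt.1 (show f.offset (i + 1) < f.offset k by omega)
      have h4 := f.offset_strictMono.lt_iff_lt.1 (show f.offset k < f.offset (i + 2) by omega)
      omega

theorem desc_partialForest_iff (σ : StarPerm n) {m : ℕ} (hm : m ≤ n) {a b : ℕ} :
    (σ.partialForest m).Desc a b ↔ σ.Below a b ∧ ∃ j : Fin n, j.val < m ∧ σ.pos j = b := by
  induction m with
  | zero =>
    simp only [not_lt_zero, false_and, exists_false, and_false, iff_false]
    rintro ⟨k, hk⟩
    exact hk
  | succ m ih =>
    have hg := gapsOf_partialForest σ (Nat.le_of_succ_le hm)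
    have hs := partialForest_succ σ ⟨m, hm⟩
    have hr := GapsOf.offset_rootOfLeaf_succ (j := ⟨m, hm⟩) hg
    have hb := GapsOf.below_pos_iff (j := ⟨m, hm⟩) (a := a) hg
    simp only at hs
    rw [hs, Forest.desc_addCaret, ih (by omega), hr, ← hb]
    constructor
    · rintro (⟨h1, j, hj, rfl⟩ | ⟨h1, h2⟩)
      · exact ⟨h1, j, by omega, rfl⟩
      · obtain rfl : b = σ.pos ⟨m, hm⟩ := by omega
        exact ⟨h2, ⟨m, hm⟩, Nat.lt_succ_self m, rfl⟩
    · rintro ⟨h1, j, hj, rfl⟩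
      rcases (Nat.lt_succ_iff.1 hj).lt_or_eq with h2 | h2
      · exact Or.inl ⟨h1, j, h2, rfl⟩
      · obtain rfl : j = ⟨m, hm⟩ := Fin.ext h2
        exact Or.inr ⟨rfl, h1⟩

theorem desc_forest_iff {σ : StarPerm n} {a b : ℕ} : σ.forest.Desc a b ↔ σ.Below a b := by
  rw [← partialForest_length, desc_partialForest_iff σ le_rfl]
  refine and_iff_left_of_imp fun h => ?_
  obtain ⟨j, hj⟩ := exists_pos_eq h.1
  exact ⟨j, j.2, hj⟩

theorem Sim.below_iff {ρ σ : StarPerm n} (h : ρ.Sim σ) (a b : ℕ) :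
    ρ.Below a b ↔ σ.Below a b := by
  rw [Sim] at h
  rw [← desc_forest_iff, ← desc_forest_iff, ← Forest.desc_delinearize, h,
    Forest.desc_delinearize]

/-! ### The action of the Thompson monoid on forests -/

/-- The right action of words on forest shapes: `xᵢ` joins the roots `i` and `i + 1`. -/
def actWord (f : Forest Unit) (w : FreeMonoid ℕ) : Forest Unit :=
  w.toList.foldl (fun (f : Forest Unit) i => f.addCaret i ()) f

theorem delinearize_forest (σ : StarPerm n) :
    σ.forest.delinearize = actWord (fun _ => BinaryTree.nil) σ.word := by
  have key (m : ℕ) (hm : m ≤ n) : (σ.partialForest m).delinearize =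
      ((List.ofFn σ.inv).take m).foldl (fun (f : Forest Unit) i => f.addCaret i ())
        (fun _ => BinaryTree.nil) := by
    induction m with
    | zero => rfl
    | succ m ih =>
      have hs := partialForest_succ σ ⟨m, hm⟩
      have hr := GapsOf.rootOfLeaf_eq_inv (j := ⟨m, hm⟩)
        (gapsOf_partialForest σ (Nat.le_of_succ_le hm))
      simp only at hs
      rw [hs, hr, Forest.delinearize_addCaret, ih (by omega), List.take_add_one]
      simp [Nat.lt_of_succ_le hm]
  rw [← partialForest_length, key n le_rfl, List.take_of_length_le (by simp)]
  rfl

theorem addCaret_comm {L : Type} (f : Forest L) {i j : ℕ} (h : i < j) (x y : L) :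
    (f.addCaret i x).addCaret j y = (f.addCaret (j + 1) y).addCaret i x := by
  funext k
  simp only [Forest.addCaret]
  split_ifs <;> first | rfl | omega

theorem conGen_rel_of_mk_eq {v w : FreeMonoid ℕ}
    (h : PresentedMonoid.mk ThompsonRel v = PresentedMonoid.mk ThompsonRel w) :
    ConGen.Rel ThompsonRel v w :=
  Quotient.exact (s := (conGen ThompsonRel).toSetoid) h

theorem actWord_eq_of_mk_eq {v w : FreeMonoid ℕ}
    (h : PresentedMonoid.mk ThompsonRel v = PresentedMonoid.mk ThompsonRel w) (f : Forest Unit) :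
    actWord f v = actWord f w := by
  replace h := conGen_rel_of_mk_eq h
  induction h generalizing f with
  | of v w h =>
    obtain ⟨i, j, h⟩ := h
    exact addCaret_comm f h () ()
  | refl => rfl
  | symm _ ih => exact (ih f).symm
  | trans _ _ ih1 ih2 => exact (ih1 f).trans (ih2 f)
  | mul _ _ ih1 ih2 =>
    simp only [actWord, FreeMonoid.toList_mul, List.foldl_append] at *
    rw [ih1, ih2]

theorem length_eq_of_mk_eq {v w : FreeMonoid ℕ}
    (h : PresentedMonoid.mk ThompsonRel v = PresentedMonoid.mk ThompsonRel w) :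
    v.length = w.length := by
  replace h := conGen_rel_of_mk_eq h
  induction h with
  | of v w h =>
    obtain ⟨i, j, h⟩ := h
    rfl
  | refl => rfl
  | symm _ ih => exact ih.symm
  | trans _ _ ih1 ih2 => exact ih1.trans ih2
  | mul _ _ ih1 ih2 => rw [FreeMonoid.length_mul, FreeMonoid.length_mul, ih1, ih2]

/-- The words of two `*`-permutations represent the same element of the Thompson monoid exactly
when the forests have the same shape. -/
theorem sim_iff_mk_word_eq {ρ σ : StarPerm n} : ρ.Sim σ ↔
    PresentedMonoid.mk ThompsonRel ρ.word = PresentedMonoid.mk ThompsonRel σ.word := by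
  constructor
  · exact fun h => mk_word_eq_of_below (Sim.below_iff h)
  · intro h
    rw [Sim, delinearize_forest, delinearize_forest, actWord_eq_of_mk_eq h]

theorem sim_iff_below_iff {ρ σ : StarPerm n} :
    ρ.Sim σ ↔ ∀ a b, ρ.Below a b ↔ σ.Below a b :=
  ⟨fun h => Sim.below_iff h, fun h => sim_iff_mk_word_eq.2 (mk_word_eq_of_below h)⟩

end StarPerm

/-! ### Fixed positions of the stars -/

namespace SPrime

variable {n : ℕ} {A : Finset ℕ}

theorem coe_toPerm (hA : A.card = n) (σ : SPrime n A) (i : Fin n) :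
    (σ.toPerm hA i : WithTop (Fin n)) = σ.1.toFun (A.orderEmbOfFin hA i) :=
  coe_removeStars hA σ i

theorem exists_orderEmbOfFin_eq (hA : A.card = n) {p : ℕ} (hp : p ∈ A) :
    ∃ i, A.orderEmbOfFin hA i = p := by
  have : p ∈ Set.range (A.orderEmbOfFin hA) := by
    rw [Finset.range_orderEmbOfFin]
    exact hp
  exact this

theorem eq_top_iff (σ ρ : SPrime n A) (p : ℕ) : σ.1.toFun p = ⊤ ↔ ρ.1.toFun p = ⊤ := by
  rw [← not_iff_not]
  exact (σ.2 p).trans (ρ.2 p).symm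

theorem toPerm_surjective (hA : A.card = n) :
    Function.Surjective (toPerm hA : SPrime n A → Equiv.Perm (Fin n)) := by
  intro α
  have hinj : Function.Injective fun j => A.orderEmbOfFin hA (α.symm j) :=
    (A.orderEmbOfFin hA).injective.comp α.symm.injective
  refine ⟨⟨StarPerm.ofPos _ hinj, fun p => ⟨fun h => ?_, fun h => ?_⟩⟩, ?_⟩
  · obtain ⟨j, rfl⟩ := StarPerm.exists_pos_eq h
    rw [StarPerm.pos_ofPos]
    exact A.orderEmbOfFin_mem hA _
  · obtain ⟨i, rfl⟩ := exists_orderEmbOfFin_eq hA h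
    rw [(StarPerm.pos_eq_iff (j := α i)).1 (by simp [StarPerm.pos_ofPos])]
    exact WithTop.coe_ne_top
  · ext1 i
    exact WithTop.coe_inj.1 ((coe_toPerm hA _ i).trans
      (StarPerm.pos_eq_iff.1 (by simp [StarPerm.pos_ofPos])))

/-- The weak order is the containment of inversion sets, an inversion being a pair of positions of
concrete symbols. -/
theorem le'_iff (hA : A.card = n) (σ ρ : SPrime n A) : LE' hA σ ρ ↔
    ∀ a b, a < b → a ∈ A → σ.1.toFun b < σ.1.toFun a → ρ.1.toFun b < ρ.1.toFun a := by
  rw [LE', weakLE_iff_inversions_subset]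
  constructor
  · intro h a b hab ha hlt
    obtain ⟨i, rfl⟩ := exists_orderEmbOfFin_eq hA ha
    obtain ⟨j, rfl⟩ := exists_orderEmbOfFin_eq hA ((σ.2 b).1 hlt.ne_top)
    rw [← coe_toPerm, ← coe_toPerm, WithTop.coe_lt_coe] at hlt ⊢
    exact (mem_inversions.1 (h (mem_inversions.2
      ⟨(A.orderEmbOfFin hA).lt_iff_lt.1 hab, hlt⟩))).2
  · rintro h ⟨i, j⟩ hij
    rw [mem_inversions] at hij ⊢
    have := h _ _ ((A.orderEmbOfFin hA).lt_iff_lt.2 hij.1) (A.orderEmbOfFin_mem hA i)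
    rw [← coe_toPerm, ← coe_toPerm, ← coe_toPerm, ← coe_toPerm, WithTop.coe_lt_coe,
      WithTop.coe_lt_coe] at this
    exact ⟨hij.1, this hij.2⟩

/-! ### The classes are intervals -/

theorem le'_of_avoids132 (hA : A.card = n) {ρ top : SPrime n A} (htop : top.1.Avoids132)
    (h : ∀ a b, ρ.1.Below a b ↔ top.1.Below a b) : LE' hA ρ top := by
  rw [le'_iff]
  intro a b hab ha hlt
  by_contra hcon
  have hb : top.1.toFun b ≠ ⊤ := (eq_top_iff ρ top b).not.1 hlt.ne_top
  have hlt' : top.1.toFun a < top.1.toFun b :=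
    lt_of_le_of_ne (not_lt.1 hcon) fun e => hab.ne (StarPerm.toFun_injOn e ((top.2 a).2 ha))
  exact ((h a b).2 (htop.below hab hb hlt')).le.not_gt hlt

theorem le'_of_avoids231 (hA : A.card = n) {ρ bot : SPrime n A} (hbot : bot.1.Avoids231)
    (h : ∀ a b, ρ.1.Below a b ↔ bot.1.Below a b) : LE' hA bot ρ := by
  rw [le'_iff]
  intro a b hab ha hlt
  exact ((h b a).2 (hbot.below hab ((bot.2 a).2 ha) hlt)).lt hab.ne'

/-- Between two elements of a class every element satisfies the relations that define the class: of
the relations between positions, those pointing to the right hold below the top, and those pointing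
to the left hold above the bottom. -/
theorem below_iff_of_mem_interval (hA : A.card = n) {bot top ρ : SPrime n A}
    (h : ∀ a b, top.1.Below a b ↔ bot.1.Below a b) (hρ : ρ ∈ interval hA bot top) (a b : ℕ) :
    bot.1.Below a b ↔ ρ.1.Below a b := by
  refine StarPerm.below_iff_of_imp (eq_top_iff bot ρ) (fun a b hab => ?_) a b
  have hbA : b ∈ A := (bot.2 b).1 hab.1
  rcases lt_trichotomy a b with h1 | rfl | h1
  · by_contra hcon
    have haA : a ∈ A := (bot.2 a).1 fun e => hab.1 (top_le_iff.1 (e.symm.le.trans hab.le))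
    have := (le'_iff hA ρ top).1 hρ.2 a b h1 haA (not_le.1 hcon)
    exact ((h a b).2 hab).le.not_gt this
  · exact le_rfl
  · exact ((le'_iff hA bot ρ).1 hρ.1 b a h1 hbA (hab.lt h1.ne')).le

theorem mem_of_below_iff (σ : SPrime n A) {m : ℕ} {ρ : StarPerm m}
    (h : ∀ a, ρ.Below a a ↔ σ.1.Below a a) (p : ℕ) : ρ.toFun p ≠ ⊤ ↔ p ∈ A := by
  rw [← StarPerm.below_self_iff, h, StarPerm.below_self_iff, σ.2]

/-- The `132`-avoiding and the `231`-avoiding element with the `Below` relation of the class are its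
bounds. -/
theorem exists_class_eq_interval (hA : A.card = n) (σ : SPrime n A) :
    ∃ bot top : SPrime n A, {ρ : SPrime n A | ρ.1.Sim σ.1} = interval hA bot top ∧
      LE' hA bot top ∧ top.1.Avoids132 ∧ bot.1.Avoids231 := by
  obtain ⟨bot, hbot, hbot'⟩ := StarPerm.exists_avoids231 σ.1
  obtain ⟨top, ⟨htop, -⟩, htop'⟩ := StarPerm.exists_avoids132 σ.1
  let bot' : SPrime n A := ⟨bot, mem_of_below_iff σ fun a => hbot a a⟩
  let top' : SPrime n A := ⟨top, mem_of_below_iff σ fun a => htop a a⟩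
  refine ⟨bot', top', ?_, le'_of_avoids132 hA htop' fun a b => (hbot a b).trans (htop a b).symm,
    htop', hbot'⟩
  ext ρ
  rw [Set.mem_ofPred_eq, StarPerm.sim_iff_below_iff]
  constructor
  · intro h
    exact ⟨le'_of_avoids231 hA hbot' fun a b => (h a b).trans (hbot a b).symm,
      le'_of_avoids132 hA htop' fun a b => (h a b).trans (htop a b).symm⟩
  · intro h a b
    rw [← below_iff_of_mem_interval hA (fun a b => (htop a b).trans (hbot a b).symm) h]
    exact hbot a b

/-! ### The classes are unions of Tamari classes -/

theorem toFun_ofPerm (α : Equiv.Perm (Fin n)) (i : Fin n) :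
    (StarPerm.ofPerm α).toFun i = (α i : WithTop (Fin n)) := by
  simp [StarPerm.ofPerm]

theorem below_ofPerm_iff {α : Equiv.Perm (Fin n)} {i j : Fin n} :
    (StarPerm.ofPerm α).Below i j ↔ ∀ k ∈ Set.uIcc i j, α k ≤ α j := by
  simp only [StarPerm.Below, toFun_ofPerm]
  constructor
  · rintro ⟨-, h⟩ k hk
    have := h k (by rw [Set.mem_uIcc] at *; exact hk)
    rwa [toFun_ofPerm, WithTop.coe_le_coe] at this
  · intro h
    refine ⟨WithTop.coe_ne_top, fun c hc => ?_⟩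
    rw [Set.mem_uIcc] at hc
    have hcn : c < n := by omega
    have := h ⟨c, hcn⟩ (by rw [Set.mem_uIcc]; exact hc)
    rw [← WithTop.coe_le_coe, ← toFun_ofPerm α ⟨c, hcn⟩] at this
    exact this

/-- `Below a b` holds exactly when no star stands from position `a` to position `b` and the
corresponding relation holds after removal of the stars. -/
theorem below_iff (hA : A.card = n) (σ : SPrime n A) (a b : ℕ) :
    σ.1.Below a b ↔ (∀ c ∈ Set.uIcc a b, c ∈ A) ∧
      ∀ i j, A.orderEmbOfFin hA i = a → A.orderEmbOfFin hA j = b →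
        (StarPerm.ofPerm (σ.toPerm hA)).Below i j := by
  have huIcc (i j k : Fin n) : A.orderEmbOfFin hA k ∈
      Set.uIcc (A.orderEmbOfFin hA i) (A.orderEmbOfFin hA j) ↔ k ∈ Set.uIcc i j := by
    simp only [Set.mem_uIcc, OrderEmbedding.le_iff_le]
  constructor
  · intro h
    refine ⟨fun c hc => (σ.2 c).1 fun e => h.1 (top_le_iff.1 (e.symm.le.trans (h.2 c hc))), ?_⟩
    rintro i j rfl rfl
    rw [below_ofPerm_iff]
    intro k hk
    rw [← WithTop.coe_le_coe, coe_toPerm, coe_toPerm]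
    exact h.2 _ ((huIcc i j k).2 hk)
  · rintro ⟨h1, h2⟩
    obtain ⟨i, rfl⟩ := exists_orderEmbOfFin_eq hA (h1 a Set.left_mem_uIcc)
    obtain ⟨j, rfl⟩ := exists_orderEmbOfFin_eq hA (h1 b Set.right_mem_uIcc)
    refine ⟨(σ.2 _).2 (h1 _ Set.right_mem_uIcc), fun c hc => ?_⟩
    obtain ⟨k, rfl⟩ := exists_orderEmbOfFin_eq hA (h1 c hc)
    rw [← coe_toPerm, ← coe_toPerm, WithTop.coe_le_coe]
    exact below_ofPerm_iff.1 (h2 i j rfl rfl) k ((huIcc i j k).1 hc)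

theorem sim_of_tamariRel (hA : A.card = n) {ρ σ : SPrime n A}
    (h : TamariRel (ρ.toPerm hA) (σ.toPerm hA)) : ρ.1.Sim σ.1 := by
  rw [StarPerm.sim_iff_below_iff]
  intro a b
  rw [below_iff hA, below_iff hA]
  simp only [StarPerm.Sim.below_iff h]

theorem exists_tamariClasses (hA : A.card = n) (σ : SPrime n A) :
    ∃ 𝒟 ⊆ tamariClasses n, toPerm hA '' {ρ : SPrime n A | ρ.1.Sim σ.1} = ⋃₀ 𝒟 := by
  refine ⟨{D | ∃ ρ : SPrime n A, ρ.1.Sim σ.1 ∧ D = {β | TamariRel β (ρ.toPerm hA)}}, ?_, ?_⟩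
  · rintro D ⟨ρ, -, rfl⟩
    exact ⟨_, rfl⟩
  · ext β
    constructor
    · rintro ⟨ρ, hρ, rfl⟩
      exact ⟨_, ⟨ρ, hρ, rfl⟩, rfl⟩
    · rintro ⟨_, ⟨ρ, hρ, rfl⟩, hβ⟩
      obtain ⟨β, rfl⟩ := toPerm_surjective hA β
      exact ⟨β, (sim_of_tamariRel hA hβ).trans hρ, rfl⟩

end SPrime

/-! ### The elements of the Thompson monoid as intervals -/

theorem StarPerm.exists_finset {n : ℕ} (σ : StarPerm n) :
    ∃ A : Finset ℕ, A.card = n ∧ ∀ p, σ.toFun p ≠ ⊤ ↔ p ∈ A := by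
  refine ⟨Finset.univ.image σ.pos, ?_, fun p => ?_⟩
  · rw [Finset.card_image_of_injective _ σ.pos_injective, Finset.card_univ, Fintype.card_fin]
  · rw [Finset.mem_image]
    constructor
    · intro h
      obtain ⟨j, hj⟩ := exists_pos_eq h
      exact ⟨j, Finset.mem_univ j, hj⟩
    · rintro ⟨j, -, rfl⟩
      rw [toFun_pos]
      exact WithTop.coe_ne_top

theorem mainTheorem4 :
    (∀ (n : ℕ) (A : Finset ℕ) (hA : A.card = n), ∀ C ∈ SPrime.classes n A,
      (∃ bot top : SPrime n A,
        C = SPrime.interval hA bot top ∧ SPrime.LE' hA bot top ∧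
          top.1.Avoids132 ∧ bot.1.Avoids231) ∧
      (∃ 𝒟 ⊆ tamariClasses n, SPrime.toPerm hA '' C = ⋃₀ 𝒟)) ∧
    (∀ g : ThompsonP2, ∃ (n : ℕ) (A : Finset ℕ) (hA : A.card = n) (bot top : SPrime n A),
      SPrime.interval hA bot top ∈ SPrime.classes n A ∧
      SPrime.LE' hA bot top ∧
      top.1.Avoids132 ∧ bot.1.Avoids231 ∧
      {s : Σ m, StarPerm m | PresentedMonoid.mk ThompsonRel s.2.word = g} =
        {s | ∃ ρ ∈ SPrime.interval hA bot top, s = ⟨n, ρ.1⟩} ∧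
      Set.BijOn (fun ρ : SPrime n A => ρ.1.word) (SPrime.interval hA bot top)
        {w | PresentedMonoid.mk ThompsonRel w = g}) := by
  constructor
  · rintro n A hA C ⟨σ, rfl⟩
    exact ⟨SPrime.exists_class_eq_interval hA σ, SPrime.exists_tamariClasses hA σ⟩
  · intro g
    obtain ⟨w, rfl⟩ := PresentedMonoid.surjective_mk g
    obtain ⟨σ, hσ⟩ := StarPerm.exists_word_eq w
    obtain ⟨A, hA, hmem⟩ := σ.exists_finset
    obtain ⟨bot, top, hC, hle, htop, hbot⟩ := SPrime.exists_class_eq_interval hA ⟨σ, hmem⟩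
    have hiff (ρ : SPrime w.length A) : ρ ∈ SPrime.interval hA bot top ↔
        PresentedMonoid.mk ThompsonRel ρ.1.word = PresentedMonoid.mk ThompsonRel w := by
      rw [← hC, Set.mem_ofPred_eq, StarPerm.sim_iff_mk_word_eq, hσ]
    have hexists (m : ℕ) (ρ : StarPerm m)
        (h : PresentedMonoid.mk ThompsonRel ρ.word = PresentedMonoid.mk ThompsonRel w) :
        ∃ ρ' ∈ SPrime.interval hA bot top,
          (⟨m, ρ⟩ : Σ m, StarPerm m) = ⟨w.length, ρ'.1⟩ := by
      obtain rfl : m = w.length := by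
        rw [← StarPerm.length_eq_of_mk_eq h, StarPerm.length_word]
      have hsim : ρ.Sim σ := by rw [StarPerm.sim_iff_mk_word_eq, h, hσ]
      exact ⟨⟨ρ, SPrime.mem_of_below_iff ⟨σ, hmem⟩ fun a => hsim.below_iff a a⟩,
        (hiff _).2 h, rfl⟩
    refine ⟨w.length, A, hA, bot, top, ⟨_, hC.symm⟩, hle, htop, hbot, ?_, ?_, ?_, ?_⟩
    · ext s
      constructor
      · exact hexists s.1 s.2
      · rintro ⟨ρ, hρ, rfl⟩
        exact (hiff ρ).1 hρ
    · exact fun ρ hρ => (hiff ρ).1 hρ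
    · exact fun ρ _ ρ' _ h => Subtype.ext (StarPerm.word_injective h)
    · intro v hv
      obtain ⟨ρ, hρ⟩ := StarPerm.exists_word_eq v
      obtain ⟨ρ', hρ', h⟩ := hexists _ ρ (by rw [hρ]; exact hv)
      have := congrArg (fun s : Σ m, StarPerm m => s.2.word) h
      exact ⟨ρ', hρ', this.symm.trans hρ⟩
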